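/- Let $\mathbb F$ be a field and let $A=\bigoplus_{i\ge 0}A_i$ be a graded associative unital $\mathbb F$-algebra such that $A_0$ is a semisimple (hence Artinian) ring, $A_iA_j=A_{i+j}$ for all $i,j\ge 0$, and $\dim_{\mathbb F}A_1<\infty$. Put $J=\bigoplus_{i\ge1}A_i$ and regard $A_0=A/J$ as a graded left $A$-module concentrated in degree $0$. For a $\mathbb Z$-graded left $A$-module $M=\bigoplus_{j\in\mathbb Z} M_j$, a minimal graded projective resolution of $M$ is an exact sequence $\cdots\to P_1\to P_0\to M\to 0$ of graded modules and homomorphisms of degree $0$, with all $P_n$ projective, such that the kernel of the map starting at $P_n$ is contained in $JP_n$ for every $n\ge 0$. A graded module $P$ is generated in degree $s$ if $P=A P_s$. Fix integers $d\ge p\ge 2$ and, for $n\ge 0$ with remainder $r\in\{0,\dots,p-1\}$ modulo $p$, put $\delta^d_p(n)=\frac{(n-r)d}{p}+r$. The algebra $A$ is called piecewise-Koszul if $A_0$ has a minimal graded projective resolution whose $n$-th term is generated in degree $\delta^d_p(n)$ for all $n\ge0$. For such an $A$, a finitely generated graded module $M$ is called a piecewise-Koszul module if, for some integer $s$, it has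 a minimal graded projective resolution whose $n$-th term is generated in degree $\delta^d_p(n)+s$ for all $n\ge 0$ (with the same $p$ and $d$). Let $E(A)=\bigoplus_{n\ge0}\mathrm{Ext}^n_A(A_0,A_0)$, a ring under the Yoneda product, and let $\mathcal E(M)=\bigoplus_{n\ge0}\mathrm{Ext}^n_A(M,A_0)$, a graded left $E(A)$-module under the Yoneda product; here $\mathrm{Ext}_A$ is taken in the category of all left $A$-modules. **Theorem.** Let $A$ be a piecewise-Koszul algebra (with respect to $p$ and $d$) and let $M$ be a finitely generated graded left $A$-module that is generated in degree $0$. Then $M$ is a piecewise-Koszul module if and only if $\mathcal E(M)$ is generated as an $E(A)$-module by its component $\mathrm{Ext}^0_A(M,A_0)=\mathrm{Hom}_A(M,A_0)$ of degree $0$. -/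

import Mathlib

open CategoryTheory
open scoped DirectSum

/-! ### The Yoneda algebra of an object and its action on Ext-groups -/

section Yoneda

universe w v u

variable {C : Type u} [Category.{v} C] [Abelian C] [HasExt.{w} C]

/-- The family of Ext-groups `n ↦ Ext^n(X, Y)`. -/
abbrev YonedaExt (X Y : C) (n : ℕ) : Type w := Abelian.Ext.{w} X Y n

/-- A Yoneda product does not depend, as an element of the graded family, on the way in which its
degree is written. -/
theorem YonedaExt.mk_comp_eq {X Y Z : C} {a b m n : ℕ} (α : YonedaExt.{w} X Y a)
    (β : YonedaExt.{w} Y Z b) (hm : a + b = m) (h : m = n) (γ : YonedaExt.{w} X Z n)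
    (hγ : α.comp β (hm.trans h) = γ) :
    (⟨m, α.comp β hm⟩ : GradedMonoid (YonedaExt.{w} X Z)) = ⟨n, γ⟩ := by
  subst h
  rw [← hγ]

/-- The Yoneda product on `Ext^*(Y, Y)`: the product of `g ∈ Ext^i(Y, Y)` and `h ∈ Ext^j(Y, Y)`
is `g ∘ h ∈ Ext^{i+j}(Y, Y)` (Mathlib's `comp` is written in diagrammatic order). -/
noncomputable instance YonedaExt.gMul (Y : C) : GradedMonoid.GMul (YonedaExt.{w} Y Y) where
  mul {i j} g h := h.comp g (add_comm j i)

noncomputable instance YonedaExt.gOne (Y : C) : GradedMonoid.GOne (YonedaExt.{w} Y Y) where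
  one := Abelian.Ext.mk₀ (𝟙 Y)

theorem YonedaExt.mk_assoc {X Y Z T : C} {a b c : ℕ} (α : YonedaExt.{w} Z T a)
    (β : YonedaExt.{w} Y Z b) (γ : YonedaExt.{w} X Y c) :
    (⟨a + b + c, γ.comp (β.comp α (add_comm b a)) (add_comm c (a + b))⟩ :
      GradedMonoid (YonedaExt.{w} X T)) =
      ⟨a + (b + c), (γ.comp β (add_comm c b)).comp α (add_comm (b + c) a)⟩ :=
  YonedaExt.mk_comp_eq _ _ _ (add_assoc a b c) _
    (Abelian.Ext.comp_assoc γ β α (add_comm c b) (add_comm b a) (by omega)).symm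

noncomputable instance YonedaExt.gMonoid (Y : C) : GradedMonoid.GMonoid (YonedaExt.{w} Y Y) where
  one_mul a := YonedaExt.mk_comp_eq a.2 _ _ (zero_add a.1) a.2 (Abelian.Ext.comp_mk₀_id _)
  mul_one a := YonedaExt.mk_comp_eq _ a.2 _ (add_zero a.1) a.2 (Abelian.Ext.mk₀_id_comp _)
  mul_assoc a b c := YonedaExt.mk_assoc a.2 b.2 c.2

noncomputable instance YonedaExt.gRing (Y : C) : DirectSum.GRing (YonedaExt.{w} Y Y) where
  __ := YonedaExt.gMonoid Y
  mul_zero _ := Abelian.Ext.zero_comp _ _ _ _ _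
  zero_mul _ := Abelian.Ext.comp_zero _ _ _ _ _
  mul_add _ _ _ := Abelian.Ext.add_comp _ _ _ _
  add_mul _ _ _ := Abelian.Ext.comp_add _ _ _ _
  natCast n := n • Abelian.Ext.mk₀ (𝟙 Y)
  natCast_zero := zero_nsmul _
  natCast_succ n := succ_nsmul _ n
  intCast n := n • Abelian.Ext.mk₀ (𝟙 Y)
  intCast_ofNat n := natCast_zsmul _ n
  intCast_negSucc_ofNat n := negSucc_zsmul _ n

/-- The left action of `Ext^*(Y, Y)` on `Ext^*(X, Y)` by Yoneda products. -/
noncomputable instance YonedaExt.gmodule (X Y : C) :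
    DirectSum.Gmodule (YonedaExt.{w} Y Y) (YonedaExt.{w} X Y) where
  smul {i j} g h := h.comp g (add_comm j i)
  one_smul a := YonedaExt.mk_comp_eq a.2 _ _ (zero_add a.1) a.2 (Abelian.Ext.comp_mk₀_id _)
  mul_smul a b c := YonedaExt.mk_assoc a.2 b.2 c.2
  smul_add _ _ _ := Abelian.Ext.add_comp _ _ _ _
  smul_zero _ := Abelian.Ext.zero_comp _ _ _ _ _
  add_smul _ _ _ := Abelian.Ext.comp_add _ _ _ _
  zero_smul _ := Abelian.Ext.comp_zero _ _ _ _ _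

end Yoneda

/-! ### Graded algebras and graded modules -/

namespace PiecewiseKoszul

universe v u

section

variable {F : Type v} [Field F] {A : Type u} [Ring A] [Algebra F A]

/-- The standing assumptions on a graded algebra `A = ⨁_{i ≥ 0} A_i`: the ring `A_0` is semisimple
(hence Artinian), `A_i A_j = A_{i+j}` for all `i, j ≥ 0`, and `A_1` is finite dimensional. -/
structure IsStandard (𝒜 : ℕ → Submodule F A) [GradedAlgebra 𝒜] : Prop where
  semisimple : IsSemisimpleRing (𝒜 0)
  mul_eq : ∀ i j : ℕ, 𝒜 i * 𝒜 j = 𝒜 (i + j)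
  finite_one : Module.Finite F (𝒜 1)

/-- A `ℤ`-graded left module over `A = ⨁_{i ≥ 0} A_i`. (The homogeneous components are
automatically `F`-subspaces, since the image of `F` lies in `A_0`.) -/
structure GrMod (𝒜 : ℕ → Submodule F A) : Type (u + 1) where
  carrier : Type u
  [addCommGroup : AddCommGroup carrier]
  [module : Module A carrier]
  /-- the homogeneous components -/
  deg : ℤ → AddSubgroup carrier
  isInternal : DirectSum.IsInternal deg
  smul_mem : ∀ (i : ℕ) (j : ℤ), ∀ a ∈ 𝒜 i, ∀ x ∈ deg j, a • x ∈ deg (i + j)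

attribute [instance] GrMod.addCommGroup GrMod.module

/-- `M` is generated in degree `s`, that is, `M = A M_s`. -/
def GrMod.GeneratedIn {𝒜 : ℕ → Submodule F A} (M : GrMod 𝒜) (s : ℤ) : Prop :=
  Submodule.span A (M.deg s : Set M.carrier) = ⊤

/-- A homomorphism of graded modules (of degree zero). -/
def IsGradedHom {𝒜 : ℕ → Submodule F A} {M N : GrMod 𝒜} (f : M.carrier →ₗ[A] N.carrier) : Prop :=
  ∀ j : ℤ, ∀ x ∈ M.deg j, f x ∈ N.deg j

/-- `J M`, where `J = ⨁_{i ≥ 1} A_i` is the graded Jacobson radical of `A`. -/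
def GrMod.radical {𝒜 : ℕ → Submodule F A} (M : GrMod 𝒜) : Submodule A M.carrier :=
  Submodule.span A {y | ∃ i : ℕ, 1 ≤ i ∧ ∃ a ∈ 𝒜 i, ∃ x : M.carrier, y = a • x}

/-- A minimal graded projective resolution `⋯ → P_1 → P_0 → M → 0`: an exact sequence of graded
modules and graded homomorphisms of degree zero, with every `P_n` projective, in which the kernel
of each map that starts at `P_n` is contained in `J P_n`. -/
structure MinimalResolution {𝒜 : ℕ → Submodule F A} (M : GrMod 𝒜) where
  obj : ℕ → GrMod 𝒜
  projective : ∀ n, Module.Projective A (obj n).carrier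
  d : ∀ n, (obj (n + 1)).carrier →ₗ[A] (obj n).carrier
  ε : (obj 0).carrier →ₗ[A] M.carrier
  d_graded : ∀ n, IsGradedHom (d n)
  ε_graded : IsGradedHom ε
  ε_surjective : Function.Surjective ε
  exact_zero : Function.Exact (d 0) ε
  exact_succ : ∀ n, Function.Exact (d (n + 1)) (d n)
  minimal_zero : LinearMap.ker ε ≤ (obj 0).radical
  minimal_succ : ∀ n, LinearMap.ker (d n) ≤ (obj (n + 1)).radical

/-- The function `δ^d_p(n) = (n - r) d / p + r`, where `r ∈ {0, …, p - 1}` is the remainder of `n`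
modulo `p`. Here `n / p` is the integral quotient, so that `n - r = (n / p) p`. -/
def delta (p d n : ℕ) : ℕ := n / p * d + n % p

end

section

variable {F : Type v} [Field F] {A : Type u} [Ring A] [Algebra F A]
  (𝒜 : ℕ → Submodule F A) [GradedAlgebra 𝒜]

/-- The underlying abelian group of the trivial `A`-module `A_0`. -/
def TrivialModule : Type u := 𝒜 0

instance TrivialModule.instAddCommGroup : AddCommGroup (TrivialModule 𝒜) :=
  inferInstanceAs (AddCommGroup (𝒜 0))

/-- `A` acts on `A_0` through the projection `A → A_0`, that is, through `A / J ≅ A_0`. -/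
instance TrivialModule.instModule : Module A (TrivialModule 𝒜) :=
  letI : Module (𝒜 0) (TrivialModule 𝒜) := inferInstanceAs (Module (𝒜 0) (𝒜 0))
  Module.compHom (TrivialModule 𝒜) (GradedRing.projZeroRingHom' 𝒜)

/-- The trivial graded `A`-module `A_0`, concentrated in degree zero. -/
def trivialGrMod : GrMod 𝒜 where
  carrier := TrivialModule 𝒜
  deg j := if j = 0 then ⊤ else ⊥
  isInternal := by
    classical
    refine ⟨fun x y hxy => ?_, fun x => ⟨DirectSum.of
      (fun j : ℤ => ((if j = 0 then ⊤ else ⊥ : AddSubgroup (TrivialModule 𝒜)) : Type u)) 0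
      ⟨x, by simp⟩, by simp⟩⟩
    have key : ∀ z : ⨁ j : ℤ, ((if j = 0 then ⊤ else ⊥ : AddSubgroup (TrivialModule 𝒜)) : Type u),
        DirectSum.coeAddMonoidHom (fun j : ℤ => if j = 0 then ⊤ else ⊥) z = z 0 := by
      intro z
      induction z using DirectSum.induction_on with
      | zero => simp
      | of i z =>
        by_cases hi : i = 0
        · subst hi
          simp
        · have hz : z = 0 := Subtype.ext (by simpa [hi] using z.2)
          simp [hz]
      | add a b ha hb => rw [map_add, ha, hb, DirectSum.add_apply, AddSubgroup.coe_add]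
    rw [key, key] at hxy
    refine DFinsupp.ext fun j => ?_
    by_cases hj : j = 0
    · subst hj
      exact Subtype.ext hxy
    · have h0 : ∀ z : ((if j = 0 then ⊤ else ⊥ : AddSubgroup (TrivialModule 𝒜)) : Type u),
          z = 0 := fun z => Subtype.ext (by simpa [hj] using z.2)
      rw [h0 (x j), h0 (y j)]
  smul_mem i j a ha x hx := by
    by_cases hj : j = 0
    · subst hj
      by_cases hi : i = 0
      · simp [hi]
      · have h0 : GradedRing.projZeroRingHom' 𝒜 a = 0 := Subtype.ext (by
          simp [DirectSum.decompose_of_mem_ne 𝒜 ha hi])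
        have h1 : a • x = 0 := by
          change (GradedRing.projZeroRingHom' 𝒜 a * (show 𝒜 0 from x) : 𝒜 0) = 0
          rw [h0, zero_mul]
        rw [h1]
        exact zero_mem _
    · have h1 : x = 0 := by simpa [hj] using hx
      rw [h1, smul_zero]
      exact zero_mem _

/-- `A` is a piecewise-Koszul algebra with period `p` and jump degree `d`. -/
def IsPiecewiseKoszulAlgebra (p d : ℕ) : Prop :=
  ∃ P : MinimalResolution (trivialGrMod 𝒜), ∀ n, (P.obj n).GeneratedIn (delta p d n : ℤ)

variable {𝒜} in
/-- `M` is a piecewise-Koszul module (with respect to the period `p` and the jump degree `d`). -/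
def IsPiecewiseKoszulModule (p d : ℕ) (M : GrMod 𝒜) : Prop :=
  ∃ s : ℤ, ∃ Q : MinimalResolution M, ∀ n, (Q.obj n).GeneratedIn ((delta p d n : ℤ) + s)

/-- The Yoneda-Ext algebra `E(A) = ⨁_n Ext^n_A(A_0, A_0)`, as a ring. -/
abbrev YonedaAlgebra : Type u :=
  ⨁ n : ℕ, YonedaExt.{u} (ModuleCat.of A (TrivialModule 𝒜)) (ModuleCat.of A (TrivialModule 𝒜)) n

variable {𝒜} in
/-- The Koszul dual `⨁_n Ext^n_A(M, A_0)` of `M`, a left module over `E(A)`. -/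
abbrev KoszulDual (M : GrMod 𝒜) : Type u :=
  ⨁ n : ℕ, YonedaExt.{u} (ModuleCat.of A M.carrier) (ModuleCat.of A (TrivialModule 𝒜)) n

variable {𝒜} in
/-- The Koszul dual of `M` is generated, as an `E(A)`-module, by its component
`Ext^0_A(M, A_0)` of degree zero. -/
def KoszulDualGeneratedInDegreeZero (M : GrMod 𝒜) : Prop :=
  Submodule.span (YonedaAlgebra 𝒜)
    (Set.range (DirectSum.of (YonedaExt.{u} (ModuleCat.of A M.carrier)
      (ModuleCat.of A (TrivialModule 𝒜))) 0) : Set (KoszulDual M)) = ⊤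

end

end PiecewiseKoszul

/-! Since `M` is finitely generated and `A_0` is semisimple, `M / JM` embeds in a finite direct sum
`N` of copies of `A_0`; let `f : M → N` be the resulting map, with kernel `JM`. A direct sum of
copies of the resolution of `A_0` is a minimal resolution of `N` whose terms are generated in the
degrees `δ(n)`. Both conditions of the theorem are compared with a third: `f` induces surjections
`Ext^n(N, A_0) → Ext^n(M, A_0)` for all `n`.

For generation in degree zero the comparison is formal: the Ext-groups of `N` form a finite sum of
copies of `E(A)`, the induced map is `E(A)`-linear, and it is surjective in degree zero
(`extSurjective_of_koszulDualGeneratedInDegreeZero`,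
`koszulDualGeneratedInDegreeZero_of_extSurjective`).

For the piecewise-Koszul property, dimension shifting (`exists_syzygyMap`) trades `f` for the
induced map `k` of first syzygies and lowers the Ext-degree by one. In Ext-degree zero, surjectivity
means injectivity modulo `J`, because modules killed by `J` are semisimple and cogenerated by `A_0`.
If the resolutions of `M` and `N` are generated in the same degrees, injectivity modulo `J` lifts to
the covers, where it becomes split injectivity; hence `k` is injective, and also injective modulo
`J`, as both syzygies are generated in one common degree (`extSurjective_of_injective_mod_radical`).
Conversely, surjectivity on Ext makes `k` injective modulo `J` into a module generated in degree
`δ(1)`, so by the graded Nakayama lemma the syzygy of `M` is generated in that degree as well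
(`ExtDominated.syzygy`). Induction along the syzygies gives both directions. -/

/-! ### Dimension shifting for maps induced on Ext -/

section ExtShift

universe w v u

variable {C : Type u} [Category.{v} C] [Abelian C] [HasExt.{w} C]

/-- Precomposition with `f` is surjective on `Ext^n(-, Y)`. -/
def ExtPrecompSurjective {M N : C} (f : M ⟶ N) (Y : C) (n : ℕ) : Prop :=
  Function.Surjective fun α : Abelian.Ext.{w} N Y n =>
    (Abelian.Ext.mk₀ f).comp α (zero_add n)

theorem extPrecompSurjective_zero_iff {M N : C} (f : M ⟶ N) (Y : C) :
    ExtPrecompSurjective.{w} f Y 0 ↔ ∀ g : M ⟶ Y, ∃ h : N ⟶ Y, f ≫ h = g := by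
  constructor
  · intro H g
    obtain ⟨α, hα⟩ := H (Abelian.Ext.mk₀ g)
    obtain ⟨h, rfl⟩ := (Abelian.Ext.mk₀_bijective _ _).2 α
    exact ⟨h, (Abelian.Ext.mk₀_bijective _ _).1 (by simpa using hα)⟩
  · intro H β
    obtain ⟨g, rfl⟩ := (Abelian.Ext.mk₀_bijective _ _).2 β
    obtain ⟨h, rfl⟩ := H g
    exact ⟨Abelian.Ext.mk₀ h, by simp⟩

/-- By the long exact sequence the kernel comes from `Ext^n(S.X₂, Y)`. This group vanishes for `n >
0` by projectivity, and for `n = 0` its restriction to `S.X₁` vanishes by `hz`, the form in which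
minimality of a cover enters. -/
theorem extClass_comp_injective {S : ShortComplex C} (hS : S.ShortExact) [Projective S.X₂] (Y : C)
    (hz : ∀ g : S.X₂ ⟶ Y, S.f ≫ g = 0) (n : ℕ) (α : Abelian.Ext.{w} S.X₁ Y n)
    (hα : hS.extClass.comp α (add_comm 1 n) = 0) : α = 0 := by
  obtain ⟨β, rfl⟩ := Abelian.Ext.contravariant_sequence_exact₁ hS Y α (add_comm 1 n) hα
  cases n with
  | zero =>
    obtain ⟨g, rfl⟩ := (Abelian.Ext.mk₀_bijective _ _).2 β
    simp [hz g]
  | succ n => rw [Abelian.Ext.eq_zero_of_projective β, Abelian.Ext.comp_zero]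

/-- Dimension shifting for the surjectivity of a map induced on Ext-groups. -/
theorem extPrecompSurjective_succ_iff {S T : ShortComplex C} (hS : S.ShortExact)
    (hT : T.ShortExact) (f : S ⟶ T) [Projective S.X₂] [Projective T.X₂] (Y : C)
    (hz : ∀ g : S.X₂ ⟶ Y, S.f ≫ g = 0) (n : ℕ) :
    ExtPrecompSurjective.{w} f.τ₃ Y (n + 1) ↔ ExtPrecompSurjective.{w} f.τ₁ Y n := by
  -- Naturality of the extension class: the connecting maps of the two rows intertwine the maps
  -- induced by `f.τ₁` and `f.τ₃`.
  have comm : ∀ α : Abelian.Ext.{w} T.X₁ Y n,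
      (Abelian.Ext.mk₀ f.τ₃).comp (hT.extClass.comp α (add_comm 1 n)) (zero_add (n + 1)) =
        hS.extClass.comp ((Abelian.Ext.mk₀ f.τ₁).comp α (zero_add n)) (add_comm 1 n) := by
    intro α
    rw [← Abelian.Ext.comp_assoc (a₁₂ := 1) _ _ _ (by lia) (by lia) (by lia),
      ← ShortComplex.ShortExact.extClass_naturality hS hT f,
      Abelian.Ext.comp_assoc (a₂₃ := n) _ _ _ (by lia) (by lia) (by lia)]
  constructor
  · intro H β
    obtain ⟨γ, hγ⟩ := H (hS.extClass.comp β (add_comm 1 n))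
    obtain ⟨α, rfl⟩ := Abelian.Ext.contravariant_sequence_exact₃ hT Y γ
      (Abelian.Ext.eq_zero_of_projective _) (add_comm 1 n)
    refine ⟨α, sub_eq_zero.1 (extClass_comp_injective hS Y hz n _ ?_)⟩
    dsimp only at hγ ⊢
    rw [comm] at hγ
    rw [sub_eq_add_neg, Abelian.Ext.comp_add, Abelian.Ext.comp_neg, hγ, add_neg_cancel]
  · intro H β
    obtain ⟨α, rfl⟩ := Abelian.Ext.contravariant_sequence_exact₃ hS Y β
      (Abelian.Ext.eq_zero_of_projective _) (add_comm 1 n)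
    obtain ⟨γ, rfl⟩ := H α
    exact ⟨_, comm γ⟩

/-- Dimension shifting along a commutative diagram of modules with short exact rows. -/
theorem ModuleCat.extPrecompSurjective_succ_iff {A : Type u} [Ring A]
    {K P M K' P' M' Y : Type u} [AddCommGroup K] [AddCommGroup P] [AddCommGroup M]
    [AddCommGroup K'] [AddCommGroup P'] [AddCommGroup M'] [AddCommGroup Y]
    [Module A K] [Module A P] [Module A M] [Module A K'] [Module A P'] [Module A M'] [Module A Y]
    [Module.Projective A P] [Module.Projective A P']
    (i : K →ₗ[A] P) (q : P →ₗ[A] M) (i' : K' →ₗ[A] P') (q' : P' →ₗ[A] M')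
    (hi : Function.Injective i) (he : Function.Exact i q) (hq : Function.Surjective q)
    (hi' : Function.Injective i') (he' : Function.Exact i' q') (hq' : Function.Surjective q')
    (k : K →ₗ[A] K') (φ : P →ₗ[A] P') (f : M →ₗ[A] M')
    (h₁ : i' ∘ₗ k = φ ∘ₗ i) (h₂ : q' ∘ₗ φ = f ∘ₗ q)
    (hz : ∀ g : P →ₗ[A] Y, g ∘ₗ i = 0) (n : ℕ) :
    ExtPrecompSurjective.{u} (ModuleCat.ofHom f) (ModuleCat.of A Y) (n + 1) ↔
      ExtPrecompSurjective.{u} (ModuleCat.ofHom k) (ModuleCat.of A Y) n := by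
  let S : ShortComplex (ModuleCat.{u} A) :=
    ShortComplex.mk (ModuleCat.ofHom i) (ModuleCat.ofHom q) (by
      rw [← ModuleCat.ofHom_comp, he.linearMap_comp_eq_zero]; rfl)
  let T : ShortComplex (ModuleCat.{u} A) :=
    ShortComplex.mk (ModuleCat.ofHom i') (ModuleCat.ofHom q') (by
      rw [← ModuleCat.ofHom_comp, he'.linearMap_comp_eq_zero]; rfl)
  have hS : S.ShortExact :=
    { exact := (ShortComplex.ShortExact.moduleCat_exact_iff_function_exact S).2 he
      mono_f := (ModuleCat.mono_iff_injective _).2 hi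
      epi_g := (ModuleCat.epi_iff_surjective _).2 hq }
  have hT : T.ShortExact :=
    { exact := (ShortComplex.ShortExact.moduleCat_exact_iff_function_exact T).2 he'
      mono_f := (ModuleCat.mono_iff_injective _).2 hi'
      epi_g := (ModuleCat.epi_iff_surjective _).2 hq' }
  let F : S ⟶ T :=
    { τ₁ := ModuleCat.ofHom k
      τ₂ := ModuleCat.ofHom φ
      τ₃ := ModuleCat.ofHom f
      comm₁₂ := by
        change ModuleCat.ofHom k ≫ ModuleCat.ofHom i' = ModuleCat.ofHom i ≫ ModuleCat.ofHom φ
        rw [← ModuleCat.ofHom_comp, ← ModuleCat.ofHom_comp, h₁]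
      comm₂₃ := by
        change ModuleCat.ofHom φ ≫ ModuleCat.ofHom q' = ModuleCat.ofHom q ≫ ModuleCat.ofHom f
        rw [← ModuleCat.ofHom_comp, ← ModuleCat.ofHom_comp, h₂] }
  have : Projective S.X₂ := (IsProjective.iff_projective P).1 inferInstance
  have : Projective T.X₂ := (IsProjective.iff_projective P').1 inferInstance
  refine _root_.extPrecompSurjective_succ_iff hS hT F _ (fun g => ?_) n
  refine ModuleCat.hom_ext ?_
  exact hz g.hom

theorem ModuleCat.extPrecompSurjective_zero_iff {A : Type u} [Ring A] {M N Y : Type u}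
    [AddCommGroup M] [AddCommGroup N] [AddCommGroup Y] [Module A M] [Module A N] [Module A Y]
    (f : M →ₗ[A] N) :
    ExtPrecompSurjective.{u} (ModuleCat.ofHom f) (ModuleCat.of A Y) 0 ↔
      ∀ g : M →ₗ[A] Y, ∃ h : N →ₗ[A] Y, h ∘ₗ f = g := by
  rw [_root_.extPrecompSurjective_zero_iff]
  constructor
  · intro H g
    obtain ⟨h, hh⟩ := H (ModuleCat.ofHom g)
    exact ⟨h.hom, congrArg ModuleCat.Hom.hom hh⟩
  · intro H g
    obtain ⟨h, hh⟩ := H g.hom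
    exact ⟨ModuleCat.ofHom h, ModuleCat.hom_ext hh⟩

end ExtShift

namespace PiecewiseKoszul

universe v u

/-! ### Graded modules: projections, homogeneous submodules, direct sums -/

section Graded

variable {F : Type v} [Field F] {A : Type u} [Ring A] [Algebra F A]

/-- The map `π j` recovers the `j`-th component of a sum, whence injectivity; the spanning condition
gives surjectivity. -/
theorem isInternal_of_proj {X : Type*} [AddCommGroup X] (D : ℤ → AddSubgroup X)
    (π : ℤ → X →+ X) (hsame : ∀ j, ∀ x ∈ D j, π j x = x)
    (hne : ∀ i j, i ≠ j → ∀ x ∈ D i, π j x = 0) (hsup : ∀ x, x ∈ ⨆ j, D j) :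
    DirectSum.IsInternal D := by
  classical
  have key : ∀ (z : ⨁ j, D j) (j : ℤ), π j (DirectSum.coeAddMonoidHom D z) = z j := by
    intro z j
    induction z using DirectSum.induction_on with
    | zero => simp
    | of i z =>
      rw [DirectSum.coeAddMonoidHom_of]
      by_cases h : i = j
      · subst h
        rw [hsame _ _ z.2, DirectSum.of_eq_same]
      · rw [hne i j h _ z.2, DirectSum.of_eq_of_ne _ _ _ (Ne.symm h)]
        rfl
    | add a b ha hb => rw [map_add, map_add, ha, hb, DirectSum.add_apply, AddSubgroup.coe_add]
  refine ⟨fun a b hab => ?_, fun x => ?_⟩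
  · refine DFinsupp.ext fun j => Subtype.ext ?_
    rw [← key a j, ← key b j, hab]
  · rw [← AddMonoidHom.mem_range]
    refine (iSup_le fun j y hy => ?_ : (⨆ j, D j) ≤ (DirectSum.coeAddMonoidHom D).range) (hsup x)
    exact ⟨DirectSum.of (fun j => D j) j ⟨y, hy⟩, DirectSum.coeAddMonoidHom_of _ _ _⟩

namespace GrMod

variable {𝒜 : ℕ → Submodule F A}

/-- The projection of a graded module onto its component of degree `j`. -/
noncomputable def proj (M : GrMod 𝒜) (j : ℤ) : M.carrier →+ M.carrier :=
  letI := M.isInternal.chooseDecomposition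
  (M.deg j).subtype.comp ((DFinsupp.evalAddMonoidHom j).comp
    (DirectSum.decomposeAddEquiv M.deg).toAddMonoidHom)

variable (M : GrMod 𝒜)

theorem proj_mem (j : ℤ) (x : M.carrier) : M.proj j x ∈ M.deg j :=
  letI := M.isInternal.chooseDecomposition
  (DirectSum.decompose M.deg x j).2

variable {M} in
theorem proj_of_mem {j : ℤ} {x : M.carrier} (hx : x ∈ M.deg j) : M.proj j x = x :=
  letI := M.isInternal.chooseDecomposition
  DirectSum.decompose_of_mem_same M.deg hx

variable {M} in
theorem proj_of_mem_ne {i j : ℤ} {x : M.carrier} (hx : x ∈ M.deg i) (h : i ≠ j) :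
    M.proj j x = 0 :=
  letI := M.isInternal.chooseDecomposition
  DirectSum.decompose_of_mem_ne M.deg hx h

variable {M} in
@[elab_as_elim]
theorem induction {motive : M.carrier → Prop} (x : M.carrier) (zero : motive 0)
    (mem : ∀ j, ∀ x ∈ M.deg j, motive x) (add : ∀ x y, motive x → motive y → motive (x + y)) :
    motive x :=
  letI := M.isInternal.chooseDecomposition
  DirectSum.Decomposition.inductionOn M.deg zero (fun {j} y => mem j y y.2) add x

theorem sum_proj (x : M.carrier) : ∃ t : Finset ℤ, x = ∑ j ∈ t, M.proj j x := by
  classical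
  let := M.isInternal.chooseDecomposition
  exact ⟨_, (DirectSum.sum_support_decompose M.deg x).symm⟩

theorem mem_of_proj_mem {x : M.carrier} {W : AddSubgroup M.carrier}
    (h : ∀ j, M.proj j x ∈ W) : x ∈ W := by
  obtain ⟨t, ht⟩ := M.sum_proj x
  rw [ht]
  exact sum_mem fun j _ => h j

theorem proj_smul {i : ℕ} {a : A} (ha : a ∈ 𝒜 i) (x : M.carrier) (j : ℤ) :
    M.proj j (a • x) = a • M.proj (j - i) x := by
  induction x using GrMod.induction with
  | zero => simp
  | mem k x hx =>
    have h := M.smul_mem i k a ha x hx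
    by_cases hj : k = j - i
    · subst hj
      rw [add_sub_cancel] at h
      rw [proj_of_mem hx, proj_of_mem h]
    · rw [proj_of_mem_ne hx hj, proj_of_mem_ne h (by lia), smul_zero]
  | add x y hx hy => rw [smul_add, map_add, map_add, hx, hy, smul_add]

theorem map_proj {M N : GrMod 𝒜} {f : M.carrier →ₗ[A] N.carrier} (hf : IsGradedHom f) (j : ℤ)
    (x : M.carrier) : f (M.proj j x) = N.proj j (f x) := by
  induction x using GrMod.induction with
  | zero => simp
  | mem k x hx =>
    by_cases h : k = j
    · subst h
      rw [proj_of_mem hx, proj_of_mem (hf _ _ hx)]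
    · rw [proj_of_mem_ne hx h, proj_of_mem_ne (hf _ _ hx) h, map_zero]
  | add x y hx hy => simp only [map_add, hx, hy]

/-- A homogeneous submodule of a graded module, as a graded module. -/
def sub (W : Submodule A M.carrier) (hW : ∀ j, ∀ x ∈ W, M.proj j x ∈ W) : GrMod 𝒜 where
  carrier := W
  deg j := (M.deg j).comap W.subtype.toAddMonoidHom
  isInternal := by
    refine isInternal_of_proj _
      (fun j => ((M.proj j).comp W.subtype.toAddMonoidHom).codRestrict W.toAddSubgroup
        fun x => hW j x x.2) (fun j x hx => Subtype.ext ?_)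
      (fun i j h x hx => Subtype.ext ?_) (fun x => ?_)
    · exact proj_of_mem (M := M) hx
    · exact proj_of_mem_ne (M := M) hx h
    · obtain ⟨t, ht⟩ := M.sum_proj x
      have : x = ∑ j ∈ t, (⟨M.proj j x, hW j x x.2⟩ : W) := Subtype.ext (by simpa using ht)
      rw [this]
      exact sum_mem fun j _ => AddSubgroup.mem_iSup_of_mem j (M.proj_mem j x)
  smul_mem i j a ha x hx := M.smul_mem i j a ha x hx

theorem sub_proj (W : Submodule A M.carrier) (hW : ∀ j, ∀ x ∈ W, M.proj j x ∈ W) (j : ℤ)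
    (x : W) : W.subtype ((M.sub W hW).proj j x) = M.proj j x :=
  map_proj (M := M.sub W hW) (f := W.subtype) (fun _ _ h => h) j x

/-- The kernel of a graded homomorphism, as a graded module. -/
abbrev ker {M N : GrMod 𝒜} (f : M.carrier →ₗ[A] N.carrier) (hf : IsGradedHom f) : GrMod 𝒜 :=
  M.sub (LinearMap.ker f) fun j x hx => by
    rw [LinearMap.mem_ker] at hx ⊢
    rw [map_proj hf, hx, map_zero]

/-- The range of a graded homomorphism, as a graded module. -/
abbrev range {M N : GrMod 𝒜} (f : M.carrier →ₗ[A] N.carrier) (hf : IsGradedHom f) : GrMod 𝒜 :=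
  N.sub (LinearMap.range f) fun j x hx => by
    obtain ⟨y, rfl⟩ := hx
    exact ⟨M.proj j y, map_proj hf j y⟩

/-- A direct sum of copies of a graded module. -/
noncomputable def finsupp (ι : Type u) : GrMod 𝒜 where
  carrier := ι →₀ M.carrier
  deg j :=
    { carrier := {x | ∀ i, x i ∈ M.deg j}
      add_mem' := fun hx hy i => add_mem (hx i) (hy i)
      zero_mem' := fun i => zero_mem _
      neg_mem' := fun hx i => neg_mem (hx i) }
  isInternal := by
    refine isInternal_of_proj _ (fun j => Finsupp.mapRange.addMonoidHom (M.proj j))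
      (fun j x hx => Finsupp.ext fun i => ?_)
      (fun i j h x hx => Finsupp.ext fun k => ?_) (fun x => ?_)
    · exact proj_of_mem (hx i)
    · exact proj_of_mem_ne (hx k) h
    · induction x using Finsupp.induction_linear with
      | zero => exact zero_mem _
      | add x y hx hy => exact add_mem hx hy
      | single i m =>
        induction m using GrMod.induction with
        | zero => simp
        | mem j m hm =>
          refine AddSubgroup.mem_iSup_of_mem j fun k => ?_
          classical
          rw [Finsupp.single_apply]
          split
          · exact hm
          · exact zero_mem _
        | add x y hx hy => rw [Finsupp.single_add]; exact add_mem hx hy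
  smul_mem i j a ha x hx k := M.smul_mem i j a ha _ (hx k)

variable {M} in
theorem single_mem_finsupp_deg {ι : Type u} {j : ℤ} {x : M.carrier} (hx : x ∈ M.deg j) (i : ι) :
    (Finsupp.single i x : ι →₀ M.carrier) ∈ (M.finsupp ι).deg j := by
  classical
  intro k
  rw [Finsupp.single_apply]
  split
  · exact hx
  · exact zero_mem _

variable {M} in
theorem GeneratedIn.finsupp {s : ℤ} (h : M.GeneratedIn s) (ι : Type u) :
    (M.finsupp ι).GeneratedIn s := by
  refine eq_top_iff.2 fun x _ => ?_
  clear * - h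
  induction x using Finsupp.induction_linear with
  | zero => exact zero_mem _
  | add x y hx hy => exact add_mem hx hy
  | single i m =>
    have hm : m ∈ Submodule.span A (M.deg s : Set M.carrier) := by
      rw [show Submodule.span A (M.deg s : Set M.carrier) = ⊤ from h]; trivial
    induction hm using Submodule.span_induction with
    | mem x hx => exact Submodule.subset_span (single_mem_finsupp_deg hx i)
    | zero => rw [Finsupp.single_zero]; exact zero_mem _
    | add x y _ _ hx hy => rw [Finsupp.single_add]; exact add_mem hx hy
    | smul a x _ hx => rw [← Finsupp.smul_single]; exact Submodule.smul_mem _ _ hx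

end GrMod

end Graded

/-! ### Shifted regular modules -/

section Graded

variable {F : Type v} [Field F] {A : Type u} [Ring A] [Algebra F A]
  (𝒜 : ℕ → Submodule F A) [GradedAlgebra 𝒜]

/-- The regular graded module, with its generator placed in degree `s`. -/
def regularGrMod (s : ℤ) : GrMod 𝒜 where
  carrier := A
  deg m :=
    { carrier := {a | ∀ i : ℕ, (i : ℤ) + s ≠ m → (DirectSum.decompose 𝒜 a i : A) = 0}
      add_mem' := fun ha hb i h => by
        rw [DirectSum.decompose_add, DirectSum.add_apply, Submodule.coe_add, ha i h, hb i h,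
          add_zero]
      zero_mem' := fun i h => by simp
      neg_mem' := fun ha i h => by
        rw [DirectSum.decompose_neg, DFinsupp.neg_apply, Submodule.coe_neg, ha i h, neg_zero] }
  isInternal := by
    have hmem : ∀ i : ℕ, ∀ a ∈ 𝒜 i, ∀ k : ℕ, (k : ℤ) + s ≠ i + s →
        (DirectSum.decompose 𝒜 a k : A) = 0 := fun i a ha k hk =>
      DirectSum.decompose_of_mem_ne 𝒜 ha (by lia)
    refine isInternal_of_proj _
      -- The component of degree `m` is `A_{m-s}`. The case split handles `m < s`, where `toNat`
      -- would return `0` and select `A_0`.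
      (fun m => if s ≤ m then (GradedRing.proj 𝒜 (m - s).toNat) else 0)
      (fun m a ha => ?_) (fun m n h a ha => ?_) (fun a => ?_)
    · have h0 : ∀ i : ℕ, (i : ℤ) + s ≠ m → (DirectSum.decompose 𝒜 a i : A) = 0 := ha
      refine (DirectSum.decompose 𝒜).injective (DFinsupp.ext fun i => Subtype.ext ?_)
      split_ifs with hm
      · by_cases hi : i = (m - s).toNat
        · subst hi
          rw [GradedRing.proj_apply, DirectSum.decompose_coe, DirectSum.of_eq_same]
        · rw [h0 i (by lia), GradedRing.proj_apply, DirectSum.decompose_coe,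
            DirectSum.of_eq_of_ne _ _ _ hi]
          rfl
      · rw [h0 i (by lia)]; simp
    · have h0 : ∀ i : ℕ, (i : ℤ) + s ≠ m → (DirectSum.decompose 𝒜 a i : A) = 0 := ha
      split_ifs with hm
      · exact h0 _ (by lia)
      · rfl
    · induction a using DirectSum.Decomposition.inductionOn 𝒜 with
      | zero => exact zero_mem _
      | homogeneous a => exact AddSubgroup.mem_iSup_of_mem _ (hmem _ a a.2)
      | add a b ha hb => exact add_mem ha hb
  smul_mem i j a ha x hx k hk := by
    change (DirectSum.decompose 𝒜 (a * x) k : A) = 0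
    by_cases hik : i ≤ k
    · rw [DirectSum.coe_decompose_mul_of_left_mem_of_le 𝒜 ha hik, hx (k - i) (by lia), mul_zero]
    · rw [DirectSum.coe_decompose_mul_of_left_mem_of_not_le 𝒜 ha hik]

theorem one_mem_regularGrMod (s : ℤ) : (1 : A) ∈ (regularGrMod 𝒜 s).deg s := fun i hi =>
  DirectSum.decompose_of_mem_ne 𝒜 (SetLike.GradedOne.one_mem) (by lia)

theorem regularGrMod_generatedIn (s : ℤ) : (regularGrMod 𝒜 s).GeneratedIn s := by
  refine eq_top_iff.2 fun a _ => ?_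
  have := Submodule.smul_mem
    (Submodule.span A ((regularGrMod 𝒜 s).deg s : Set (regularGrMod 𝒜 s).carrier)) (a : A)
    (Submodule.subset_span (one_mem_regularGrMod 𝒜 s))
  exact (congrArg (· ∈ Submodule.span A _) (mul_one (M := A) a)).mp this

end Graded

/-! ### The radical and the modules killed by it -/

section Radical

variable {F : Type v} [Field F] {A : Type u} [Ring A] [Algebra F A]

/-- `J X`, for a module `X` over `A = ⨁ A_i` and `J = ⨁_{i ≥ 1} A_i`. -/
def gradedRadical (𝒜 : ℕ → Submodule F A) (X : Type*) [AddCommGroup X] [Module A X] :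
    Submodule A X :=
  Submodule.span A {y | ∃ i : ℕ, 1 ≤ i ∧ ∃ a ∈ 𝒜 i, ∃ x : X, y = a • x}

variable {𝒜 : ℕ → Submodule F A} {X Y : Type*} [AddCommGroup X] [Module A X] [AddCommGroup Y]
  [Module A Y]

theorem smul_mem_gradedRadical {i : ℕ} (hi : 1 ≤ i) {a : A} (ha : a ∈ 𝒜 i) (x : X) :
    a • x ∈ gradedRadical 𝒜 X :=
  Submodule.subset_span ⟨i, hi, a, ha, x, rfl⟩

theorem map_mem_gradedRadical (f : X →ₗ[A] Y) {x : X} (hx : x ∈ gradedRadical 𝒜 X) :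
    f x ∈ gradedRadical 𝒜 Y := by
  refine (Submodule.span_le.2 ?_ : gradedRadical 𝒜 X ≤ (gradedRadical 𝒜 Y).comap f) hx
  rintro _ ⟨i, hi, a, ha, x, rfl⟩
  rw [SetLike.mem_coe, Submodule.mem_comap, map_smul]
  exact smul_mem_gradedRadical hi ha _

theorem exists_mem_gradedRadical_of_surjective {f : X →ₗ[A] Y} (hf : Function.Surjective f)
    {y : Y} (hy : y ∈ gradedRadical 𝒜 Y) : ∃ x ∈ gradedRadical 𝒜 X, f x = y := by
  refine (Submodule.span_le.2 ?_ : gradedRadical 𝒜 Y ≤ (gradedRadical 𝒜 X).map f) hy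
  rintro _ ⟨i, hi, a, ha, y, rfl⟩
  obtain ⟨x, rfl⟩ := hf y
  exact ⟨a • x, smul_mem_gradedRadical hi ha x, map_smul f a x⟩

theorem gradedRadical_quotient_eq_bot :
    gradedRadical 𝒜 (X ⧸ gradedRadical 𝒜 X) = ⊥ := by
  refine eq_bot_iff.2 fun y hy => ?_
  obtain ⟨x, hx, rfl⟩ :=
    exists_mem_gradedRadical_of_surjective (gradedRadical 𝒜 X).mkQ_surjective hy
  exact (Submodule.Quotient.mk_eq_zero _).2 hx

theorem smul_eq_zero_of_gradedRadical_eq_bot (hX : gradedRadical 𝒜 X = ⊥) {i : ℕ} (hi : 1 ≤ i)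
    {a : A} (ha : a ∈ 𝒜 i) (x : X) : a • x = 0 := by
  rw [← Submodule.mem_bot A, ← hX]
  exact smul_mem_gradedRadical hi ha x

theorem apply_eq_zero_of_mem_gradedRadical (hY : gradedRadical 𝒜 Y = ⊥) (f : X →ₗ[A] Y) {x : X}
    (hx : x ∈ gradedRadical 𝒜 X) : f x = 0 := by
  rw [← Submodule.mem_bot A, ← hY]
  exact map_mem_gradedRadical f hx

variable [GradedAlgebra 𝒜]

/-- `A` is the sum of `A_0` and `J`, and `J` acts by zero. -/
theorem smul_eq_proj_smul (hX : gradedRadical 𝒜 X = ⊥) (a : A) (x : X) :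
    a • x = (GradedRing.projZeroRingHom' 𝒜 a : A) • x := by
  rw [GradedRing.coe_projZeroRingHom'_apply, GradedRing.projZeroRingHom_apply]
  induction a using DirectSum.Decomposition.inductionOn 𝒜 with
  | zero => simp
  | @homogeneous i a =>
    by_cases hi : i = 0
    · subst hi
      rw [DirectSum.decompose_of_mem_same 𝒜 a.2]
    · rw [DirectSum.decompose_of_mem_ne 𝒜 a.2 hi, zero_smul]
      exact smul_eq_zero_of_gradedRadical_eq_bot hX (by lia) a.2 x
  | add a b ha hb => simp only [DirectSum.decompose_add, DirectSum.add_apply, Submodule.coe_add,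
      add_smul, ha, hb]

/-- The action factors through the surjection `A → A_0`, so the identity of `X` is a bijective
semilinear map to an `A_0`-module, and `A_0` is semisimple. -/
theorem isSemisimpleModule_of_gradedRadical_eq_bot [IsSemisimpleRing (𝒜 0)]
    (hX : gradedRadical 𝒜 X = ⊥) : IsSemisimpleModule A X := by
  let : Module (𝒜 0) X := Module.compHom X (SetLike.GradeZero.subsemiring 𝒜).subtype
  have : RingHomSurjective (GradedRing.projZeroRingHom' 𝒜) :=
    ⟨GradedRing.projZeroRingHom'_surjective 𝒜⟩
  let l : X →ₛₗ[GradedRing.projZeroRingHom' 𝒜] X :=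
    { toFun := id
      map_add' := fun _ _ => rfl
      map_smul' := fun a x => smul_eq_proj_smul hX a x }
  exact (l.isSemisimpleModule_iff_of_bijective Function.bijective_id).2 inferInstance

instance [IsSemisimpleRing (𝒜 0)] : IsSemisimpleModule A (X ⧸ gradedRadical 𝒜 X) :=
  isSemisimpleModule_of_gradedRadical_eq_bot gradedRadical_quotient_eq_bot

theorem gradedRadical_trivialModule : gradedRadical 𝒜 (TrivialModule 𝒜) = ⊥ := by
  refine eq_bot_iff.2 (Submodule.span_le.2 ?_)
  rintro _ ⟨i, hi, a, ha, x, rfl⟩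
  have h0 : GradedRing.projZeroRingHom' 𝒜 a = 0 := Subtype.ext (by
    simp [DirectSum.decompose_of_mem_ne 𝒜 ha (show i ≠ 0 by lia)])
  change (GradedRing.projZeroRingHom' 𝒜 a * (show 𝒜 0 from x) : 𝒜 0) = 0
  rw [h0, zero_mul]

variable (𝒜) in
/-- The unit of `A_0`, which generates the trivial module. -/
def TrivialModule.one : TrivialModule 𝒜 := (1 : 𝒜 0)

/-- The homomorphism from the trivial module that maps `1` to `x`. -/
def TrivialModule.lift (hX : gradedRadical 𝒜 X = ⊥) (x : X) : TrivialModule 𝒜 →ₗ[A] X where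
  toFun s := ((show 𝒜 0 from s : 𝒜 0) : A) • x
  map_add' s t := by
    change ((show 𝒜 0 from s) + (show 𝒜 0 from t) : A) • x = _
    rw [add_smul]
  map_smul' a s := by
    change ((GradedRing.projZeroRingHom' 𝒜 a * (show 𝒜 0 from s) : 𝒜 0) : A) • x = a • _
    rw [smul_eq_proj_smul hX a, ← mul_smul]
    rfl

theorem TrivialModule.lift_one (hX : gradedRadical 𝒜 X = ⊥) (x : X) :
    TrivialModule.lift hX x (TrivialModule.one 𝒜) = x :=
  one_smul A x

/-- The trivial module cogenerates the modules that are annihilated by `J`. -/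
theorem exists_trivialModule_apply_ne_zero [IsSemisimpleRing (𝒜 0)]
    (hX : gradedRadical 𝒜 X = ⊥) {x : X} (hx : x ≠ 0) :
    ∃ g : X →ₗ[A] TrivialModule 𝒜, g x ≠ 0 := by
  have := isSemisimpleModule_of_gradedRadical_eq_bot hX
  have : IsSemisimpleModule A (TrivialModule 𝒜) :=
    isSemisimpleModule_of_gradedRadical_eq_bot gradedRadical_trivialModule
  let l := TrivialModule.lift hX x
  -- `σ` splits the surjection of `A_0` onto `A x`, and `g` extends `σ` to `X`. Being a section, `σ`
  -- does not kill `x`.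
  obtain ⟨σ, hσ⟩ := IsSemisimpleModule.lifting_property l.rangeRestrict l.surjective_rangeRestrict
    LinearMap.id
  obtain ⟨g, hg⟩ := IsSemisimpleModule.extension_property (LinearMap.range l).subtype
    Subtype.val_injective σ
  refine ⟨g, fun h => hx ?_⟩
  have h1 : σ ⟨x, _, TrivialModule.lift_one hX x⟩ = 0 := by
    rw [← h, ← hg]; rfl
  have h2 := LinearMap.congr_fun hσ ⟨x, _, TrivialModule.lift_one hX x⟩
  rw [LinearMap.comp_apply, h1, map_zero] at h2
  exact (congrArg Subtype.val h2).symm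

/-- A homomorphism that is injective modulo `J` can be extended along when mapping to a module
that is annihilated by `J`. -/
theorem exists_extension_of_injective_mod_gradedRadical [IsSemisimpleRing (𝒜 0)] {Z : Type*}
    [AddCommGroup Z] [Module A Z] (hZ : gradedRadical 𝒜 Z = ⊥) (f : X →ₗ[A] Y)
    (hf : ∀ x, f x ∈ gradedRadical 𝒜 Y → x ∈ gradedRadical 𝒜 X) (g : X →ₗ[A] Z) :
    ∃ h : Y →ₗ[A] Z, h ∘ₗ f = g := by
  let fbar := (gradedRadical 𝒜 X).mapQ (gradedRadical 𝒜 Y) f fun x hx => map_mem_gradedRadical f hx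
  have hfbar : Function.Injective fbar := by
    rw [← LinearMap.ker_eq_bot, eq_bot_iff]
    intro x hx
    obtain ⟨x, rfl⟩ := (gradedRadical 𝒜 X).mkQ_surjective x
    exact (Submodule.Quotient.mk_eq_zero _).2 (hf x ((Submodule.Quotient.mk_eq_zero _).1 hx))
  obtain ⟨h, hh⟩ := IsSemisimpleModule.extension_property fbar hfbar
    ((gradedRadical 𝒜 X).liftQ g fun x hx => apply_eq_zero_of_mem_gradedRadical hZ g hx)
  refine ⟨h ∘ₗ (gradedRadical 𝒜 Y).mkQ, LinearMap.ext fun x => ?_⟩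
  exact LinearMap.congr_fun hh ((gradedRadical 𝒜 X).mkQ x)

/-- If every homomorphism to the trivial module extends along `f`, then `f` is injective
modulo `J`. -/
theorem injective_mod_gradedRadical_of_exists_extension [IsSemisimpleRing (𝒜 0)] (f : X →ₗ[A] Y)
    (hf : ∀ g : X →ₗ[A] TrivialModule 𝒜, ∃ h : Y →ₗ[A] TrivialModule 𝒜, h ∘ₗ f = g) (x : X)
    (hx : f x ∈ gradedRadical 𝒜 Y) : x ∈ gradedRadical 𝒜 X := by
  by_contra hx'
  obtain ⟨g, hg⟩ := exists_trivialModule_apply_ne_zero (𝒜 := 𝒜) gradedRadical_quotient_eq_bot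
    (x := (gradedRadical 𝒜 X).mkQ x) (mt (Submodule.Quotient.mk_eq_zero _).1 hx')
  obtain ⟨h, hh⟩ := hf (g ∘ₗ (gradedRadical 𝒜 X).mkQ)
  apply hg
  rw [← LinearMap.comp_apply, ← hh]
  exact apply_eq_zero_of_mem_gradedRadical gradedRadical_trivialModule h hx

end Radical

/-! ### Generation in one degree, Nakayama's lemma, projective covers -/

section Generation

variable {F : Type v} [Field F] {A : Type u} [Ring A] [Algebra F A]
  {𝒜 : ℕ → Submodule F A}

namespace GrMod

variable {M N P Q : GrMod 𝒜}

/-- The components of `M` in degrees below `b` vanish. -/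
def BoundedBelow (M : GrMod 𝒜) (b : ℤ) : Prop := ∀ j < b, ∀ x, M.proj j x = 0

theorem BoundedBelow.sub {b : ℤ} (h : M.BoundedBelow b) (W : Submodule A M.carrier)
    (hW : ∀ j, ∀ x ∈ W, M.proj j x ∈ W) : (M.sub W hW).BoundedBelow b := fun j hj x =>
  Subtype.ext ((M.sub_proj W hW j x).trans (h j hj _))

theorem GeneratedIn.mem_span {s : ℤ} (h : M.GeneratedIn s) (x : M.carrier) :
    x ∈ Submodule.span A (M.deg s : Set M.carrier) := by
  rw [show Submodule.span A (M.deg s : Set M.carrier) = ⊤ from h]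
  trivial

theorem GeneratedIn.of_surjective {s : ℤ} (h : M.GeneratedIn s) {f : M.carrier →ₗ[A] N.carrier}
    (hf : IsGradedHom f) (hs : Function.Surjective f) : N.GeneratedIn s := by
  refine eq_top_iff.2 fun y _ => ?_
  obtain ⟨x, rfl⟩ := hs y
  refine (Submodule.span_le.2 ?_ : Submodule.span A (M.deg s : Set M.carrier) ≤
    (Submodule.span A (N.deg s : Set N.carrier)).comap f) (h.mem_span x)
  exact fun x hx => Submodule.subset_span (hf s x hx)

theorem GeneratedIn.hom_ext {s : ℤ} (h : M.GeneratedIn s) {X : Type*} [AddCommGroup X] [Module A X]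
    {f g : M.carrier →ₗ[A] X} (hfg : ∀ x ∈ M.deg s, f x = g x) : f = g :=
  LinearMap.ext_on h hfg

variable [GradedAlgebra 𝒜]

theorem proj_smul_mem {W : Submodule A M.carrier} {x : M.carrier} {j : ℤ} (a : A)
    (h : ∀ i : ℕ, ∀ b ∈ 𝒜 i, b • M.proj (j - i) x ∈ W) : M.proj j (a • x) ∈ W := by
  induction a using DirectSum.Decomposition.inductionOn 𝒜 with
  | zero => simp
  | @homogeneous i a => rw [proj_smul M a.2]; exact h i a a.2
  | add a b ha hb => rw [add_smul, map_add]; exact add_mem ha hb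

/-- The elements whose components in degrees below `b` belong to `W`. -/
def below (W : Submodule A M.carrier) (b : ℤ) : Submodule A M.carrier where
  carrier := {x | ∀ j < b, M.proj j x ∈ W}
  add_mem' hx hy j hj := by rw [map_add]; exact add_mem (hx j hj) (hy j hj)
  zero_mem' j _ := by rw [map_zero]; exact zero_mem _
  smul_mem' a x hx j hj := proj_smul_mem a fun i b _ => W.smul_mem b (hx (j - i) (by lia))

/-- Elements of `J` raise degrees by at least one, so control of `M` below `b` gives control of `JM`
below `b + 1`. This is the inductive step of Nakayama's lemma. -/
theorem radical_le_below {W : Submodule A M.carrier} {b : ℤ}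
    (h : ∀ j < b, ∀ x, M.proj j x ∈ W) : gradedRadical 𝒜 M.carrier ≤ below W (b + 1) := by
  refine Submodule.span_le.2 ?_
  rintro _ ⟨i, hi, a, ha, x, rfl⟩ j hj
  rw [proj_smul M ha]
  exact W.smul_mem a (h _ (by lia) x)

theorem BoundedBelow.proj_eq_zero_of_mem_radical {b : ℤ} (h : M.BoundedBelow b) {x : M.carrier}
    (hx : x ∈ gradedRadical 𝒜 M.carrier) {j : ℤ} (hj : j ≤ b) : M.proj j x = 0 :=
  (Submodule.mem_bot A).1
    (radical_le_below (W := ⊥) (fun j hj x => (Submodule.mem_bot A).2 (h j hj x)) hx j (by lia))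

theorem GeneratedIn.boundedBelow {s : ℤ} (h : M.GeneratedIn s) : M.BoundedBelow s := by
  intro j hj x
  refine (Submodule.mem_bot A).1
    ((Submodule.span_le.2 ?_ : Submodule.span A _ ≤ below (⊥ : Submodule A M.carrier) s)
      (h.mem_span x) j hj)
  intro y hy k hk
  rw [proj_of_mem_ne hy (by lia)]
  exact zero_mem _

theorem GeneratedIn.proj_mem_radical {s : ℤ} (h : M.GeneratedIn s) {j : ℤ} (hj : j ≠ s)
    (x : M.carrier) : M.proj j x ∈ gradedRadical 𝒜 M.carrier := by
  have hx := h.mem_span x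
  induction hx using Submodule.span_induction generalizing j with
  | mem x hx => rw [proj_of_mem_ne hx (Ne.symm hj)]; exact zero_mem _
  | zero => rw [map_zero]; exact zero_mem _
  | add x y _ _ hx hy => rw [map_add]; exact add_mem (hx hj) (hy hj)
  | smul a x _ hx =>
    refine proj_smul_mem a fun i b hb => ?_
    by_cases hi : j - i = s
    · exact smul_mem_gradedRadical (by lia) hb _
    · exact Submodule.smul_mem _ b (hx hi)

/-- `J` pushes everything above the lowest degree `s`, while components in other degrees arise from
generators by coefficients of positive degree. Congruence modulo `J` thus becomes equality in degree
`s`. -/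
theorem GeneratedIn.mem_radical_iff {s : ℤ} (h : M.GeneratedIn s) {x : M.carrier} :
    x ∈ gradedRadical 𝒜 M.carrier ↔ M.proj s x = 0 := by
  refine ⟨fun hx => h.boundedBelow.proj_eq_zero_of_mem_radical hx le_rfl, fun hx => ?_⟩
  refine M.mem_of_proj_mem (W := (gradedRadical 𝒜 M.carrier).toAddSubgroup) fun j => ?_
  by_cases hj : j = s
  · rw [hj, hx]; exact zero_mem _
  · exact h.proj_mem_radical hj x

theorem GeneratedIn.sub_proj_mem_radical {s : ℤ} (h : M.GeneratedIn s) (x : M.carrier) :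
    x - M.proj s x ∈ gradedRadical 𝒜 M.carrier := by
  rw [h.mem_radical_iff, map_sub, proj_of_mem (M.proj_mem s x), sub_self]

theorem GeneratedIn.eq_zero_of_mem_radical {s : ℤ} (h : M.GeneratedIn s) {x : M.carrier}
    (hx : x ∈ gradedRadical 𝒜 M.carrier) (hxs : x ∈ M.deg s) : x = 0 := by
  rw [← proj_of_mem hxs, h.mem_radical_iff.1 hx]

theorem GeneratedIn.eq_of_sub_mem_radical {s : ℤ} (h : M.GeneratedIn s) {x y : M.carrier}
    (hxy : x - y ∈ gradedRadical 𝒜 M.carrier) (hx : x ∈ M.deg s) (hy : y ∈ M.deg s) : x = y :=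
  sub_eq_zero.1 (h.eq_zero_of_mem_radical hxy (sub_mem hx hy))

/-- The graded version of Nakayama's lemma. -/
theorem BoundedBelow.generatedIn {b s : ℤ} (hb : M.BoundedBelow b)
    (h : ∀ j, j ≠ s → ∀ x ∈ M.deg j, x ∈ gradedRadical 𝒜 M.carrier) : M.GeneratedIn s := by
  have key : ∀ n : ℕ, ∀ j < b + n, ∀ x, M.proj j x ∈ Submodule.span A (M.deg s : Set M.carrier) := by
    intro n
    induction n with
    | zero =>
      intro j hj x
      rw [hb j (by simpa using hj) x]
      exact zero_mem _
    | succ n ih =>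
      intro j hj x
      by_cases hjs : j = s
      · exact Submodule.subset_span (hjs ▸ M.proj_mem j x)
      -- A component of degree `j ≠ s` lies in `JM`, so the induction hypothesis reaches one degree
      -- further.
      · have := radical_le_below ih (h j hjs _ (M.proj_mem j x)) j (by push_cast at hj; lia)
        rwa [proj_of_mem (M.proj_mem j x)] at this
  refine eq_top_iff.2 fun x _ => ?_
  refine M.mem_of_proj_mem (W := (Submodule.span A (M.deg s : Set M.carrier)).toAddSubgroup)
    fun j => ?_
  exact key (j - b + 1).toNat j (by lia) x

/-- The part of degree zero of a linear map between graded modules. -/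
theorem exists_gradedPart (h : P.carrier →ₗ[A] Q.carrier) : ∃ g : P.carrier →ₗ[A] Q.carrier,
    ∀ j, ∀ x ∈ P.deg j, g x = Q.proj j (h x) := by
  let := P.isInternal.chooseDecomposition
  let g : P.carrier →+ Q.carrier :=
    (DirectSum.toAddMonoid fun j =>
      (Q.proj j).comp (h.toAddMonoidHom.comp (P.deg j).subtype)).comp
      (DirectSum.decomposeAddEquiv P.deg).toAddMonoidHom
  have hg : ∀ j, ∀ x ∈ P.deg j, g x = Q.proj j (h x) := by
    intro j x hx
    change DirectSum.toAddMonoid _ (DirectSum.decompose P.deg x) = _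
    rw [DirectSum.decompose_of_mem P.deg hx, DirectSum.toAddMonoid_of]
    rfl
  refine ⟨{ g with map_smul' := fun a x => ?_ }, hg⟩
  change g (a • x) = a • g x
  induction a using DirectSum.Decomposition.inductionOn 𝒜 with
  | zero => simp
  | @homogeneous i a =>
    induction x using GrMod.induction with
    | zero => simp
    | mem j x hx =>
      rw [hg j x hx, hg _ _ (P.smul_mem i j a a.2 x hx), map_smul, proj_smul Q a.2,
        add_sub_cancel_left]
    | add x y hx hy => rw [smul_add, map_add, map_add, hx, hy, smul_add]
  | add a b ha hb => rw [add_smul, map_add, ha, hb, add_smul]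

/-- The degree-zero part of an arbitrary lift is still a lift, because `f` and `g` preserve degrees.
-/
theorem exists_graded_lift [Module.Projective A P.carrier] {g : Q.carrier →ₗ[A] N.carrier}
    (hg : IsGradedHom g) (hs : Function.Surjective g) {f : P.carrier →ₗ[A] N.carrier}
    (hf : IsGradedHom f) :
    ∃ φ : P.carrier →ₗ[A] Q.carrier, IsGradedHom φ ∧ g ∘ₗ φ = f := by
  obtain ⟨h, hh⟩ := Module.projective_lifting_property g f hs
  obtain ⟨φ, hφ⟩ := exists_gradedPart h
  refine ⟨φ, fun j x hx => hφ j x hx ▸ Q.proj_mem j _, LinearMap.ext fun x => ?_⟩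
  induction x using GrMod.induction with
  | zero => simp
  | mem j x hx =>
    rw [LinearMap.comp_apply, hφ j x hx, map_proj hg, ← LinearMap.comp_apply, hh,
      proj_of_mem (hf j x hx)]
  | add x y hx hy => rw [map_add, map_add, hx, hy]

/-- A homomorphism between graded modules generated in the same degree, with projective target,
is injective as soon as it is injective modulo `J`. -/
theorem injective_of_injective_mod_radical [IsSemisimpleRing (𝒜 0)] {s : ℤ}
    (hP : P.GeneratedIn s) [Module.Projective A Q.carrier]
    {φ : P.carrier →ₗ[A] Q.carrier} (hφ : IsGradedHom φ)
    (h : ∀ x, φ x ∈ gradedRadical 𝒜 Q.carrier → x ∈ gradedRadical 𝒜 P.carrier) :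
    Function.Injective φ := by
  -- `ρ` inverts `φ` on the left modulo `J`. It lifts to `ψ` by projectivity of `Q`, and the
  -- degree-zero part `χ` of `ψ` is a true left inverse, since in the generating degree `s`
  -- congruence modulo `J` is equality.
  obtain ⟨ρ, hρ⟩ := exists_extension_of_injective_mod_gradedRadical (𝒜 := 𝒜)
    gradedRadical_quotient_eq_bot φ h (gradedRadical 𝒜 P.carrier).mkQ
  obtain ⟨ψ, hψ⟩ := Module.projective_lifting_property (gradedRadical 𝒜 P.carrier).mkQ ρ
    (Submodule.mkQ_surjective _)
  obtain ⟨χ, hχ⟩ := exists_gradedPart ψ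
  have : χ ∘ₗ φ = LinearMap.id := by
    refine hP.hom_ext fun x hx => ?_
    rw [LinearMap.comp_apply, hχ s _ (hφ s x hx), LinearMap.id_apply]
    nth_rewrite 2 [← proj_of_mem hx]
    rw [← sub_eq_zero, ← map_sub]
    refine hP.mem_radical_iff.1 ((Submodule.Quotient.eq _).1 ?_)
    change (gradedRadical 𝒜 P.carrier).mkQ (ψ (φ x)) = (gradedRadical 𝒜 P.carrier).mkQ x
    rw [← LinearMap.comp_apply, hψ, ← LinearMap.comp_apply, hρ]
  exact Function.LeftInverse.injective (g := χ) fun x => LinearMap.congr_fun this x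

theorem smul_mem_of_mem_regularGrMod {s m : ℤ} {a : A} (ha : a ∈ (regularGrMod 𝒜 s).deg m)
    {x : M.carrier} (hx : x ∈ M.deg s) : a • x ∈ M.deg m := by
  classical
  have ha' : ∀ i : ℕ, (i : ℤ) + s ≠ m → (DirectSum.decompose 𝒜 a i : A) = 0 := ha
  rw [← DirectSum.sum_support_decompose 𝒜 a, Finset.sum_smul]
  refine sum_mem fun i _ => ?_
  by_cases hi : (i : ℤ) + s = m
  · exact hi ▸ M.smul_mem i s _ (DirectSum.decompose 𝒜 a i).2 x hx
  · rw [ha' i hi, zero_smul]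
    exact zero_mem _

/-- A graded module that is generated in a single degree has a graded projective cover. -/
theorem GeneratedIn.exists_projectiveCover [IsSemisimpleRing (𝒜 0)] {s : ℤ}
    (hM : M.GeneratedIn s) :
    ∃ (P : GrMod 𝒜) (ε : P.carrier →ₗ[A] M.carrier), Module.Projective A P.carrier ∧
      IsGradedHom ε ∧ Function.Surjective ε ∧
      LinearMap.ker ε ≤ gradedRadical 𝒜 P.carrier ∧ P.GeneratedIn s := by
  let Fr : GrMod 𝒜 := (regularGrMod 𝒜 s).finsupp (M.deg s)
  have hFr : Fr.GeneratedIn s := (regularGrMod_generatedIn 𝒜 s).finsupp _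
  have hfree : Module.Projective A (M.deg s →₀ A) := inferInstance
  have hproj : Module.Projective A Fr.carrier := hfree
  let π : Fr.carrier →ₗ[A] M.carrier :=
    Finsupp.linearCombination A (Subtype.val : M.deg s → M.carrier)
  have hπ : IsGradedHom π := fun m x hx =>
    sum_mem fun v _ => smul_mem_of_mem_regularGrMod (A := A) (hx v) v.2
  have hπs : Function.Surjective π := by
    rw [← LinearMap.range_eq_top]
    refine (Finsupp.range_linearCombination (R := A)
      (v := (Subtype.val : M.deg s → M.carrier))).trans ?_
    rw [Subtype.range_coe_subtype]
    exact hM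
  let JF := gradedRadical 𝒜 Fr.carrier
  let JM := gradedRadical 𝒜 M.carrier
  let πbar : (Fr.carrier ⧸ JF) →ₗ[A] (M.carrier ⧸ JM) :=
    JF.mapQ JM π fun x hx => map_mem_gradedRadical π hx
  have hπbar : Function.Surjective πbar := by
    intro y
    obtain ⟨y, rfl⟩ := JM.mkQ_surjective y
    obtain ⟨x, rfl⟩ := hπs y
    exact ⟨JF.mkQ x, rfl⟩
  -- The cover is a direct summand of the free module `Fr`. The idempotent `σ ∘ πbar` of `Fr / J Fr`
  -- lifts to `e'`, a priori idempotent only modulo `J`; its degree-zero part `e` is determined in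
  -- degree `s`, where `J Fr` vanishes, and so is truly idempotent.
  obtain ⟨σ, hσ⟩ := IsSemisimpleModule.lifting_property πbar hπbar LinearMap.id
  obtain ⟨e', he'⟩ := Module.projective_lifting_property JF.mkQ (σ ∘ₗ πbar ∘ₗ JF.mkQ)
    JF.mkQ_surjective
  obtain ⟨e, he⟩ := exists_gradedPart e'
  have hegr : IsGradedHom e := fun j x hx => he j x hx ▸ Fr.proj_mem j _
  have hmk : ∀ x ∈ Fr.deg s, JF.mkQ (e x) = σ (JM.mkQ (π x)) := by
    intro x hx
    have h1 : JF.mkQ (e' x) = JF.mkQ (e x) := by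
      rw [he s x hx]
      exact (Submodule.Quotient.eq _).2 (hFr.sub_proj_mem_radical _)
    rw [← h1]
    exact LinearMap.congr_fun he' x
  have hπe : π ∘ₗ e = π := by
    refine hFr.hom_ext fun x hx => hM.eq_of_sub_mem_radical ?_ (hπ s _ (hegr s x hx)) (hπ s x hx)
    refine (Submodule.Quotient.eq _).1 ?_
    change πbar (JF.mkQ (e x)) = JM.mkQ (π x)
    rw [hmk x hx]
    exact LinearMap.congr_fun hσ _
  have hee : e ∘ₗ e = e := by
    refine hFr.hom_ext fun x hx => hFr.eq_of_sub_mem_radical ?_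
      (hegr s _ (hegr s x hx)) (hegr s x hx)
    refine (Submodule.Quotient.eq _).1 ?_
    change JF.mkQ (e (e x)) = JF.mkQ (e x)
    rw [hmk _ (hegr s x hx), hmk x hx, ← LinearMap.comp_apply π, hπe]
  have hrange : ∀ x : LinearMap.range e, e x = x := by
    rintro ⟨_, x, rfl⟩
    exact LinearMap.congr_fun hee x
  have hP : (GrMod.range e hegr).GeneratedIn s :=
    hFr.of_surjective (N := GrMod.range e hegr) (f := e.rangeRestrict) hegr
      e.surjective_rangeRestrict
  refine ⟨GrMod.range e hegr, π ∘ₗ (LinearMap.range e).subtype, ?_, fun j x hx => hπ j _ hx,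
    fun y => ?_, fun x hx => ?_, hP⟩
  · exact Module.Projective.of_split (LinearMap.range e).subtype e.rangeRestrict
      (LinearMap.ext fun x => Subtype.ext (hrange x))
  · obtain ⟨x, rfl⟩ := hπs y
    exact ⟨e.rangeRestrict x, LinearMap.congr_fun hπe x⟩
  -- For `x` in the kernel, the component of degree `s` is fixed by `e`, hence congruent modulo `J`
  -- to the value of `σ` at the class of its image under `π`, which is zero.
  · rw [hP.mem_radical_iff]
    refine Subtype.ext ((Fr.sub_proj _ _ s x).trans ?_)
    have hx0 : π (x : LinearMap.range e).1 = 0 := hx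
    have h1 : e (Fr.proj s (x : LinearMap.range e).1) = Fr.proj s (x : LinearMap.range e).1 := by
      exact (map_proj hegr s _).trans (congrArg (Fr.proj s) (hrange x))
    refine hFr.eq_zero_of_mem_radical ((Submodule.Quotient.mk_eq_zero _).1 ?_) (Fr.proj_mem s _)
    change JF.mkQ (Fr.proj s (x : LinearMap.range e).1) = 0
    rw [← h1, hmk _ (Fr.proj_mem s _), map_proj hπ, hx0, map_zero, map_zero, map_zero]

end GrMod

end Generation

/-! ### Minimal resolutions, their tails and direct sums -/

section Resolutions

variable {F : Type v} [Field F] {A : Type u} [Ring A] [Algebra F A] {𝒜 : ℕ → Submodule F A}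

/-- `ε : P → M` is a graded projective cover. -/
structure IsProjectiveCover {P M : GrMod 𝒜} (ε : P.carrier →ₗ[A] M.carrier) : Prop where
  projective : Module.Projective A P.carrier
  graded : IsGradedHom ε
  surjective : Function.Surjective ε
  minimal : LinearMap.ker ε ≤ gradedRadical 𝒜 P.carrier

namespace MinimalResolution

variable {M : GrMod 𝒜} (Q : MinimalResolution M)

/-- `GrMod.radical` and `gradedRadical` unfold to the same span, so minimality transfers as it
stands. -/
theorem isProjectiveCover : IsProjectiveCover Q.ε :=
  ⟨Q.projective 0, Q.ε_graded, Q.ε_surjective, Q.minimal_zero⟩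

/-- The homomorphism from the first term of a resolution to the kernel of the augmentation. -/
def toKer : (Q.obj 1).carrier →ₗ[A] (GrMod.ker Q.ε Q.ε_graded).carrier :=
  (Q.d 0).codRestrict (LinearMap.ker Q.ε) fun x => Q.exact_zero.apply_apply_eq_zero x

theorem toKer_graded : IsGradedHom Q.toKer := Q.d_graded 0

theorem toKer_surjective : Function.Surjective Q.toKer := by
  rintro ⟨x, hx⟩
  obtain ⟨y, rfl⟩ := (Q.exact_zero x).1 hx
  exact ⟨y, rfl⟩

theorem toKer_eq_zero_iff (x : (Q.obj 1).carrier) : Q.toKer x = 0 ↔ Q.d 0 x = 0 :=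
  Subtype.ext_iff

/-- The minimal resolution of the first syzygy. -/
def tail : MinimalResolution (GrMod.ker Q.ε Q.ε_graded) where
  obj n := Q.obj (n + 1)
  projective n := Q.projective (n + 1)
  d n := Q.d (n + 1)
  ε := Q.toKer
  d_graded n := Q.d_graded (n + 1)
  ε_graded := Q.toKer_graded
  ε_surjective := Q.toKer_surjective
  exact_zero x := (Q.toKer_eq_zero_iff x).trans (Q.exact_succ 0 x)
  exact_succ n := Q.exact_succ (n + 1)
  minimal_zero x hx := Q.minimal_succ 0 ((Q.toKer_eq_zero_iff x).1 hx)
  minimal_succ n := Q.minimal_succ (n + 1)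

theorem finsupp_mem_gradedRadical {ι X : Type*} [AddCommGroup X] [Module A X] {x : ι →₀ X}
    (hx : ∀ i, x i ∈ gradedRadical 𝒜 X) : x ∈ gradedRadical 𝒜 (ι →₀ X) := by
  rw [← Finsupp.sum_single x]
  exact sum_mem fun i _ => map_mem_gradedRadical (Finsupp.lsingle i) (hx i)

theorem exact_mapRange {X Y Z : Type*} [AddCommGroup X] [Module A X] [AddCommGroup Y] [Module A Y]
    [AddCommGroup Z] [Module A Z] {f : X →ₗ[A] Y} {g : Y →ₗ[A] Z} (h : Function.Exact f g)
    (ι : Type*) : Function.Exact (Finsupp.mapRange.linearMap f : (ι →₀ X) →ₗ[A] (ι →₀ Y))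
      (Finsupp.mapRange.linearMap g) := by
  intro y
  constructor
  · intro hy
    -- Preimages are chosen with `0` sent to `0`, so that they assemble to a finitely supported
    -- function.
    have hex : ∀ z : Y, ∃ x : X, (g z = 0 → f x = z) ∧ (z = 0 → x = 0) := by
      intro z
      by_cases hz : z = 0
      · exact ⟨0, fun _ => by rw [hz, map_zero], fun _ => rfl⟩
      · by_cases hgz : g z = 0
        · obtain ⟨x, hx⟩ := (h z).1 hgz
          exact ⟨x, fun _ => hx, fun h0 => absurd h0 hz⟩
        · exact ⟨0, fun h0 => absurd h0 hgz, fun _ => rfl⟩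
    choose t ht ht0 using hex
    exact ⟨y.mapRange t (ht0 0 rfl), Finsupp.ext fun i => ht _ (DFunLike.congr_fun hy i)⟩
  · rintro ⟨x, rfl⟩
    exact Finsupp.ext fun i => h.apply_apply_eq_zero (x i)

theorem projective_finsupp (ι X : Type*) [AddCommGroup X] [Module A X] [Module.Projective A X] :
    Module.Projective A (ι →₀ X) := by
  classical
  exact Module.Projective.of_equiv' (finsuppLequivDFinsupp (ι := ι) (M := X) A).symm

/-- A direct sum of copies of a minimal resolution. -/
noncomputable def finsupp (ι : Type u) : MinimalResolution (M.finsupp ι) where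
  obj n := (Q.obj n).finsupp ι
  projective n :=
    have := Q.projective n
    projective_finsupp ι (Q.obj n).carrier
  d n := (Finsupp.mapRange.linearMap (Q.d n) : (ι →₀ (Q.obj (n + 1)).carrier) →ₗ[A] _)
  ε := (Finsupp.mapRange.linearMap Q.ε : (ι →₀ (Q.obj 0).carrier) →ₗ[A] _)
  d_graded n j _ hx i := Q.d_graded n j _ (hx i)
  ε_graded j _ hx i := Q.ε_graded j _ (hx i)
  ε_surjective := Finsupp.mapRange_surjective _ (map_zero Q.ε) Q.ε_surjective
  exact_zero := exact_mapRange Q.exact_zero ι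
  exact_succ n := exact_mapRange (Q.exact_succ n) ι
  minimal_zero _ hx := finsupp_mem_gradedRadical fun i =>
    Q.minimal_zero (DFunLike.congr_fun (F := ι →₀ _) hx i)
  minimal_succ n _ hx := finsupp_mem_gradedRadical fun i =>
    Q.minimal_succ n (DFunLike.congr_fun (F := ι →₀ _) hx i)

end MinimalResolution

/-- Because `ker p ⊆ JP`, an element of `P` that `p` sends into `JM` already lies in `JP`. -/
theorem IsProjectiveCover.injective_mod_radical {M N P Q : GrMod 𝒜} {p : P.carrier →ₗ[A] M.carrier}
    {q : Q.carrier →ₗ[A] N.carrier} (hp : IsProjectiveCover p)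
    {f : M.carrier →ₗ[A] N.carrier} {φ : P.carrier →ₗ[A] Q.carrier} (h : q ∘ₗ φ = f ∘ₗ p)
    (hf : ∀ x, f x ∈ gradedRadical 𝒜 N.carrier → x ∈ gradedRadical 𝒜 M.carrier) (x : P.carrier)
    (hx : φ x ∈ gradedRadical 𝒜 Q.carrier) : x ∈ gradedRadical 𝒜 P.carrier := by
  have h1 : p x ∈ gradedRadical 𝒜 M.carrier := hf _ (by
    rw [← LinearMap.comp_apply, ← h]
    exact map_mem_gradedRadical q hx)
  obtain ⟨y, hy, hxy⟩ := exists_mem_gradedRadical_of_surjective hp.surjective h1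
  rw [← sub_add_cancel x y]
  exact add_mem (hp.minimal (by rw [LinearMap.mem_ker, map_sub, hxy, sub_self])) hy

/-! ### Surjectivity on Ext along syzygies -/

variable [GradedAlgebra 𝒜]

/-- `f` induces a surjection `Ext^n(N, A_0) → Ext^n(M, A_0)`. -/
abbrev ExtSurjective {M N : GrMod 𝒜} (f : M.carrier →ₗ[A] N.carrier) (n : ℕ) : Prop :=
  ExtPrecompSurjective.{u} (ModuleCat.ofHom f) (ModuleCat.of A (TrivialModule 𝒜)) n

/-- Passing from a graded homomorphism to the induced homomorphism of first syzygies. -/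
theorem exists_syzygyMap {M N P Q : GrMod 𝒜} {p : P.carrier →ₗ[A] M.carrier}
    {q : Q.carrier →ₗ[A] N.carrier} (hp : IsProjectiveCover p) (hq : IsProjectiveCover q)
    {f : M.carrier →ₗ[A] N.carrier} (hf : IsGradedHom f) :
    ∃ (φ : P.carrier →ₗ[A] Q.carrier)
      (k : (GrMod.ker p hp.graded).carrier →ₗ[A] (GrMod.ker q hq.graded).carrier),
      IsGradedHom φ ∧ q ∘ₗ φ = f ∘ₗ p ∧ IsGradedHom k ∧
      (∀ x : LinearMap.ker p, (LinearMap.ker q).subtype (k x) = φ x) ∧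
      ∀ n, ExtSurjective f (n + 1) ↔ ExtSurjective k n := by
  have := hp.projective
  have := hq.projective
  obtain ⟨φ, hφ, hφq⟩ := GrMod.exists_graded_lift (P := P) hq.graded hq.surjective
    (f := f ∘ₗ p) fun j x hx => hf j _ (hp.graded j x hx)
  have hker : ∀ x ∈ LinearMap.ker p, φ x ∈ LinearMap.ker q := fun x hx => by
    rw [LinearMap.mem_ker] at hx ⊢
    rw [← LinearMap.comp_apply, hφq, LinearMap.comp_apply, hx, map_zero]
  refine ⟨φ, φ.restrict hker, hφ, hφq, fun j x hx => hφ j _ hx, fun x => rfl, fun n => ?_⟩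
  refine ModuleCat.extPrecompSurjective_succ_iff (LinearMap.ker p).subtype p
    (LinearMap.ker q).subtype q Subtype.val_injective (LinearMap.exact_subtype_ker_map p)
    hp.surjective Subtype.val_injective (LinearMap.exact_subtype_ker_map q) hq.surjective
    (φ.restrict hker) φ f rfl hφq (fun g => LinearMap.ext fun x => ?_) n
  -- Minimality feeds the dimension shift: the syzygy lies in `JP`, which every map to `A_0` kills.
  exact apply_eq_zero_of_mem_gradedRadical gradedRadical_trivialModule g (hp.minimal x.2)

/-- If `M` and `N` have minimal resolutions with terms generated in the same degrees, then a graded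
homomorphism `M → N` that is injective modulo `J` induces surjections on Ext-groups. -/
theorem extSurjective_of_injective_mod_radical [IsSemisimpleRing (𝒜 0)] {M N : GrMod 𝒜}
    (P : MinimalResolution M) (Q : MinimalResolution N) {δ : ℕ → ℤ}
    (hP : ∀ n, (P.obj n).GeneratedIn (δ n)) (hQ : ∀ n, (Q.obj n).GeneratedIn (δ n))
    {f : M.carrier →ₗ[A] N.carrier} (hf : IsGradedHom f)
    (hfr : ∀ x, f x ∈ gradedRadical 𝒜 N.carrier → x ∈ gradedRadical 𝒜 M.carrier) (n : ℕ) :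
    ExtSurjective f n := by
  induction n generalizing M N δ with
  | zero =>
    rw [ExtSurjective, ModuleCat.extPrecompSurjective_zero_iff]
    exact exists_extension_of_injective_mod_gradedRadical gradedRadical_trivialModule f hfr
  | succ n ih =>
    obtain ⟨φ, k, hφ, hφq, hk, hkφ, hext⟩ :=
      exists_syzygyMap P.isProjectiveCover Q.isProjectiveCover hf
    rw [hext]
    have := Q.projective 0
    have hinj : Function.Injective φ := GrMod.injective_of_injective_mod_radical (hP 0) hφ
      (P.isProjectiveCover.injective_mod_radical hφq hfr)
    have hkinj : Function.Injective k := fun x y hxy => Subtype.ext <| hinj <|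
      (hkφ x).symm.trans ((congrArg _ hxy).trans (hkφ y))
    refine ih P.tail Q.tail (δ := fun n => δ (n + 1)) (fun n => hP (n + 1)) (fun n => hQ (n + 1))
      hk fun x hx => ?_
    -- Both syzygies are generated in degree `δ 1`, so membership in the radical is the vanishing of
    -- one component, which the injective `k` detects.
    have hKM := (hP 1).of_surjective P.toKer_graded P.toKer_surjective
    have hKN := (hQ 1).of_surjective Q.toKer_graded Q.toKer_surjective
    rw [hKM.mem_radical_iff]
    rw [hKN.mem_radical_iff, ← GrMod.map_proj hk] at hx
    exact hkinj (hx.trans (map_zero k).symm)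

/-- `M` is generated in degree `δ 0` and maps to a graded module with a minimal resolution whose
terms are generated in the degrees `δ n`, so that surjections on Ext-groups are induced. -/
structure ExtDominated (M : GrMod 𝒜) (δ : ℕ → ℤ) : Prop where
  generatedIn : M.GeneratedIn (δ 0)
  exists_hom : ∃ (N : GrMod 𝒜) (Q : MinimalResolution N) (f : M.carrier →ₗ[A] N.carrier),
    (∀ n, (Q.obj n).GeneratedIn (δ n)) ∧ IsGradedHom f ∧ ∀ n, ExtSurjective f n

/-- Surjectivity on `Ext^1` says that maps to `A_0` extend along `k`, so `k` is injective modulo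
`J`. Homogeneous elements of degree other than `δ 1` go to the radical of the target, hence lie in
the radical of the syzygy. Nakayama's lemma applies because the syzygy is bounded below by `δ 0`. -/
theorem ExtDominated.syzygy [IsSemisimpleRing (𝒜 0)] {M P : GrMod 𝒜} {δ : ℕ → ℤ}
    (h : ExtDominated M δ) {p : P.carrier →ₗ[A] M.carrier} (hp : IsProjectiveCover p)
    (hP : P.GeneratedIn (δ 0)) :
    ExtDominated (GrMod.ker p hp.graded) fun n => δ (n + 1) := by
  obtain ⟨N, Q, f, hQ, hf, hext⟩ := h.exists_hom
  obtain ⟨φ, k, hφ, hφq, hk, hkφ, hextk⟩ := exists_syzygyMap hp Q.isProjectiveCover hf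
  refine ⟨?_, _, Q.tail, k, fun n => hQ (n + 1), hk, fun n => (hextk n).1 (hext (n + 1))⟩
  have hKN := (hQ 1).of_surjective Q.toKer_graded Q.toKer_surjective
  have hk0 := (hextk 0).1 (hext 1)
  rw [ExtSurjective, ModuleCat.extPrecompSurjective_zero_iff] at hk0
  refine (hP.boundedBelow.sub _ _).generatedIn fun j hj x hx =>
    injective_mod_gradedRadical_of_exists_extension k hk0 x ?_
  rw [hKN.mem_radical_iff]
  exact GrMod.proj_of_mem_ne (hk j x hx) hj

theorem ExtDominated.exists_cover [IsSemisimpleRing (𝒜 0)] {M : GrMod 𝒜} {δ : ℕ → ℤ}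
    (h : ExtDominated M δ) : ∃ (P : GrMod 𝒜) (p : P.carrier →ₗ[A] M.carrier),
      IsProjectiveCover p ∧ P.GeneratedIn (δ 0) := by
  obtain ⟨P, p, h1, h2, h3, h4, h5⟩ := h.generatedIn.exists_projectiveCover
  exact ⟨P, p, ⟨h1, h2, h3, h4⟩, h5⟩

variable (𝒜) in
/-- A module as in `ExtDominated` together with the sequence of degrees. -/
structure SyzygyStage : Type (u + 1) where
  mod : GrMod 𝒜
  degrees : ℕ → ℤ
  dominated : ExtDominated mod degrees

namespace SyzygyStage

variable [IsSemisimpleRing (𝒜 0)] (T : SyzygyStage 𝒜)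

/-- The graded projective cover of a stage. -/
noncomputable def cover : GrMod 𝒜 := T.dominated.exists_cover.choose

/-- The covering homomorphism of a stage. -/
noncomputable def coverMap : T.cover.carrier →ₗ[A] T.mod.carrier :=
  T.dominated.exists_cover.choose_spec.choose

theorem isProjectiveCover : IsProjectiveCover T.coverMap :=
  T.dominated.exists_cover.choose_spec.choose_spec.1

theorem cover_generatedIn : T.cover.GeneratedIn (T.degrees 0) :=
  T.dominated.exists_cover.choose_spec.choose_spec.2

/-- The kernel of the covering homomorphism, as the next stage. -/
noncomputable def next : SyzygyStage 𝒜 where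
  mod := GrMod.ker T.coverMap T.isProjectiveCover.graded
  degrees n := T.degrees (n + 1)
  dominated := T.dominated.syzygy T.isProjectiveCover T.cover_generatedIn

/-- The sequence of iterated syzygies. -/
noncomputable def iter : ℕ → SyzygyStage 𝒜
  | 0 => T
  | n + 1 => (iter n).next

theorem iter_degrees (n i : ℕ) : (T.iter n).degrees i = T.degrees (n + i) := by
  induction n generalizing i with
  | zero => rw [zero_add]; rfl
  | succ n ih => exact (ih (i + 1)).trans (by congr 1; lia)

/-- The inclusion of the next syzygy. -/
noncomputable def inclusion : T.next.mod.carrier →ₗ[A] T.cover.carrier :=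
  (LinearMap.ker T.coverMap).subtype

theorem ker_inclusion_comp {X : Type*} [AddCommGroup X] [Module A X]
    (g : X →ₗ[A] T.next.mod.carrier) : LinearMap.ker (T.inclusion ∘ₗ g) = LinearMap.ker g :=
  LinearMap.ker_comp_of_ker_eq_bot _ (Submodule.ker_subtype _)

theorem exact_inclusion_comp {X : Type*} [AddCommGroup X] [Module A X]
    {g : X →ₗ[A] T.next.mod.carrier} (hg : Function.Surjective g) :
    Function.Exact (T.inclusion ∘ₗ g) T.coverMap := by
  rw [LinearMap.exact_iff, LinearMap.range_comp, LinearMap.range_eq_top.2 hg, Submodule.map_top]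
  exact (Submodule.range_subtype _).symm

/-- The minimal resolution that is assembled from the covers of the iterated syzygies. -/
noncomputable def resolution : MinimalResolution T.mod where
  obj n := (T.iter n).cover
  projective n := (T.iter n).isProjectiveCover.projective
  d n := (T.iter n).inclusion ∘ₗ (T.iter (n + 1)).coverMap
  ε := T.coverMap
  d_graded n j x hx := (T.iter (n + 1)).isProjectiveCover.graded j x hx
  ε_graded := T.isProjectiveCover.graded
  ε_surjective := T.isProjectiveCover.surjective
  exact_zero := T.exact_inclusion_comp (T.iter 1).isProjectiveCover.surjective
  exact_succ n := by
    refine LinearMap.exact_iff.2 (((T.iter n).ker_inclusion_comp (T.iter (n + 1)).coverMap).trans ?_)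
    exact LinearMap.exact_iff.1 ((T.iter (n + 1)).exact_inclusion_comp
      (T.iter (n + 2)).isProjectiveCover.surjective)
  minimal_zero := T.isProjectiveCover.minimal
  minimal_succ n := ((T.iter n).ker_inclusion_comp (T.iter (n + 1)).coverMap).le.trans
    (T.iter (n + 1)).isProjectiveCover.minimal

end SyzygyStage

/-- `ExtDominated` passes to syzygies with the degrees shifted, so covers can be taken indefinitely;
`SyzygyStage` carries the module and its degrees through this recursion. -/
theorem ExtDominated.exists_minimalResolution [IsSemisimpleRing (𝒜 0)] {M : GrMod 𝒜} {δ : ℕ → ℤ}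
    (h : ExtDominated M δ) : ∃ Q : MinimalResolution M, ∀ n, (Q.obj n).GeneratedIn (δ n) := by
  let T : SyzygyStage 𝒜 := ⟨M, δ, h⟩
  refine ⟨T.resolution, fun n => ?_⟩
  have := (T.iter n).cover_generatedIn
  rwa [T.iter_degrees] at this

end Resolutions

/-! ### Generation of the Koszul dual versus surjectivity on Ext -/

section KoszulDual

variable {F : Type v} [Field F] {A : Type u} [Ring A] [Algebra F A]
  {𝒜 : ℕ → Submodule F A}

/-- Generation in degree `t` kills all lower degrees, in particular the generators in degree `s`. -/
theorem GrMod.GeneratedIn.subsingleton_of_lt [GradedAlgebra 𝒜] {M : GrMod 𝒜} {s t : ℤ}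
    (hs : M.GeneratedIn s) (ht : M.GeneratedIn t) (h : s < t) : Subsingleton M.carrier := by
  have : (LinearMap.id : M.carrier →ₗ[A] M.carrier) = 0 := hs.hom_ext fun x hx => by
    rw [LinearMap.id_apply, ← GrMod.proj_of_mem hx, ht.boundedBelow s h, LinearMap.zero_apply]
  exact subsingleton_of_forall_eq 0 fun x => LinearMap.congr_fun this x

theorem gradedRadical_finsupp_eq_bot {X : Type*} [AddCommGroup X] [Module A X] (ι : Type*)
    (hX : gradedRadical 𝒜 X = ⊥) : gradedRadical 𝒜 (ι →₀ X) = ⊥ := by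
  refine eq_bot_iff.2 (Submodule.span_le.2 ?_)
  rintro _ ⟨i, hi, a, ha, x, rfl⟩
  exact Finsupp.ext fun k => smul_eq_zero_of_gradedRadical_eq_bot hX hi ha (x k)

variable [GradedAlgebra 𝒜]

/-- A finitely generated module maps to a finite direct sum of copies of the trivial module with
kernel `J X`. -/
theorem exists_hom_finsupp_trivialModule [IsSemisimpleRing (𝒜 0)] (X : Type u) [AddCommGroup X]
    [Module A X] [Module.Finite A X] : ∃ (ι : Type u) (_ : Finite ι)
      (f : X →ₗ[A] ι →₀ TrivialModule 𝒜), LinearMap.ker f = gradedRadical 𝒜 X := by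
  obtain ⟨t, ht⟩ := Module.Finite.fg_top (R := A) (M := X)
  let J := gradedRadical 𝒜 X
  let π : (t →₀ TrivialModule 𝒜) →ₗ[A] X ⧸ J :=
    Finsupp.lsum ℕ fun x => TrivialModule.lift gradedRadical_quotient_eq_bot (J.mkQ x)
  have hπ : Function.Surjective π := by
    have h : (⊤ : Submodule A X) ≤ (LinearMap.range π).comap J.mkQ := by
      rw [← ht]
      refine Submodule.span_le.2 fun x hx => ?_
      refine ⟨Finsupp.single ⟨x, hx⟩ (TrivialModule.one 𝒜), ?_⟩
      exact (Finsupp.lsum_single ℕ _ _ _).trans (TrivialModule.lift_one _ _)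
    intro y
    obtain ⟨x, rfl⟩ := J.mkQ_surjective y
    exact h (Submodule.mem_top (x := x))
  have := isSemisimpleModule_of_gradedRadical_eq_bot
    (gradedRadical_finsupp_eq_bot t (gradedRadical_trivialModule (𝒜 := 𝒜)))
  -- A section of `π` embeds `X / JX` in the finite sum indexed by the generators of `X`.
  obtain ⟨σ, hσ⟩ := IsSemisimpleModule.lifting_property π hπ LinearMap.id
  refine ⟨t, inferInstance, σ ∘ₗ J.mkQ, ?_⟩
  rw [LinearMap.ker_comp_of_ker_eq_bot, Submodule.ker_mkQ]
  exact LinearMap.ker_eq_bot_of_inverse hσ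

/-- If the Koszul dual of `M` is generated in degree zero and `f` induces a surjection on
homomorphisms to `A_0`, then it induces surjections on all Ext-groups. -/
theorem extSurjective_of_koszulDualGeneratedInDegreeZero {M N : GrMod 𝒜}
    (h : KoszulDualGeneratedInDegreeZero M) (f : M.carrier →ₗ[A] N.carrier)
    (hf : ExtSurjective f 0) (n : ℕ) : ExtSurjective f n := by
  let Θ : KoszulDual N →+ KoszulDual M := DirectSum.map fun n =>
    (Abelian.Ext.mk₀ (ModuleCat.ofHom f)).precomp _ (zero_add n)
  -- Precomposition with `f` commutes with the left action by associativity of the Yoneda product,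
  -- so the range of `Θ` is an `E(A)`-submodule.
  have hΘ : ∀ (r : YonedaAlgebra 𝒜) (z : KoszulDual N), Θ (r • z) = r • Θ z := by
    intro r z
    induction r using DirectSum.induction_on with
    | zero => simp
    | add a b ha hb => rw [add_smul, map_add, ha, hb, add_smul]
    | of i e =>
      induction z using DirectSum.induction_on with
      | zero => simp
      | add a b ha hb => rw [smul_add, map_add, ha, hb, map_add, smul_add]
      | of j α =>
        rw [DirectSum.Gmodule.of_smul_of, DirectSum.map_of, DirectSum.map_of,
          DirectSum.Gmodule.of_smul_of]
        congr 1
        exact (Abelian.Ext.comp_assoc _ α e (zero_add j) (add_comm j i)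
          (by rw [zero_add, add_comm]; rfl)).symm
  let W : Submodule (YonedaAlgebra 𝒜) (KoszulDual M) :=
    { Θ.range with
      smul_mem' := by
        rintro r _ ⟨z, rfl⟩
        exact ⟨r • z, hΘ r z⟩ }
  have hW : W = ⊤ := by
    refine eq_top_iff.2 (h.ge.trans (Submodule.span_le.2 ?_))
    rintro _ ⟨y, rfl⟩
    obtain ⟨α, rfl⟩ := hf y
    exact ⟨DirectSum.of _ 0 α, DirectSum.map_of _ _ _⟩
  intro y
  obtain ⟨z, hz⟩ : DirectSum.of _ n y ∈ W := hW ▸ Submodule.mem_top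
  -- `Θ` respects degrees, so the component of degree `n` of a preimage is a preimage.
  refine ⟨z n, ?_⟩
  have := congrArg (fun w : KoszulDual M => w n) hz
  simp only [DirectSum.of_eq_same] at this
  rw [← this]
  exact (DirectSum.map_apply (fun n => (Abelian.Ext.mk₀ (ModuleCat.ofHom f)).precomp
    (ModuleCat.of A (TrivialModule 𝒜)) (zero_add n)) n z).symm

/-- If a homomorphism to a finite direct sum of copies of `A_0` induces surjections on Ext-groups,
then the Koszul dual is generated in degree zero. -/
theorem koszulDualGeneratedInDegreeZero_of_extSurjective {M : GrMod 𝒜} {ι : Type u} [Finite ι]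
    (f : M.carrier →ₗ[A] (ι →₀ TrivialModule 𝒜)) (hf : ∀ n, ExtPrecompSurjective.{u}
      (ModuleCat.ofHom f) (ModuleCat.of A (TrivialModule 𝒜)) n) :
    KoszulDualGeneratedInDegreeZero M := by
  classical
  have := Fintype.ofFinite ι
  refine eq_top_iff.2 fun z _ => ?_
  clear * - hf this
  induction z using DirectSum.induction_on with
  | zero => exact zero_mem _
  | add x y hx hy => exact add_mem hx hy
  | of n y =>
    obtain ⟨α, rfl⟩ := hf n y
    let single (i : ι) : ModuleCat.of A (TrivialModule 𝒜) ⟶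
        ModuleCat.of A (ι →₀ TrivialModule 𝒜) := ModuleCat.ofHom (Finsupp.lsingle i)
    let coord (i : ι) : ModuleCat.of A (ι →₀ TrivialModule 𝒜) ⟶
        ModuleCat.of A (TrivialModule 𝒜) := ModuleCat.ofHom (Finsupp.lapply i)
    -- As `ι` is finite, the identity splits into coordinates. Inserted between `f` and `α`, it
    -- expresses their product as an `E(A)`-combination of the coordinates of `f`, which have degree
    -- zero.
    have hid : 𝟙 (ModuleCat.of A (ι →₀ TrivialModule 𝒜)) = ∑ i, coord i ≫ single i := by
      refine ModuleCat.hom_ext (LinearMap.ext fun x => ?_)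
      rw [ModuleCat.hom_sum, LinearMap.sum_apply]
      exact (Finsupp.univ_sum_single x).symm
    have hsmul : ∀ i, DirectSum.of (YonedaExt.{u} (ModuleCat.of A M.carrier)
        (ModuleCat.of A (TrivialModule 𝒜))) n
          ((Abelian.Ext.mk₀ (ModuleCat.ofHom f ≫ coord i)).comp
            ((Abelian.Ext.mk₀ (single i)).comp α (zero_add n)) (zero_add n)) =
        DirectSum.of (YonedaExt.{u} (ModuleCat.of A (TrivialModule 𝒜))
          (ModuleCat.of A (TrivialModule 𝒜))) n
            ((Abelian.Ext.mk₀ (single i)).comp α (zero_add n)) •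
          DirectSum.of (YonedaExt.{u} (ModuleCat.of A M.carrier)
            (ModuleCat.of A (TrivialModule 𝒜))) 0
              (Abelian.Ext.mk₀ (ModuleCat.ofHom f ≫ coord i)) := fun i => by
      rw [DirectSum.Gmodule.of_smul_of]
      rfl
    have hα : (Abelian.Ext.mk₀ (ModuleCat.ofHom f)).comp α (zero_add n) =
        ∑ i, (Abelian.Ext.mk₀ (ModuleCat.ofHom f ≫ coord i)).comp
          ((Abelian.Ext.mk₀ (single i)).comp α (zero_add n)) (zero_add n) := by
      conv_lhs => rw [← Abelian.Ext.mk₀_id_comp α, hid, Abelian.Ext.mk₀_sum, Abelian.Ext.sum_comp,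
        Abelian.Ext.comp_sum]
      simp only [Abelian.Ext.mk₀_comp_mk₀_assoc, Category.assoc]
    dsimp only
    rw [hα, map_sum]
    refine sum_mem fun i _ => ?_
    rw [hsmul]
    exact Submodule.smul_mem _ _ (Submodule.subset_span ⟨_, rfl⟩)

theorem extSurjective_of_subsingleton {M N : GrMod 𝒜} [Subsingleton M.carrier]
    (f : M.carrier →ₗ[A] N.carrier) (n : ℕ) : ExtSurjective f n := by
  intro y
  refine ⟨0, ?_⟩
  have h0 : 𝟙 (ModuleCat.of A M.carrier) = 0 :=
    ModuleCat.hom_ext (LinearMap.ext fun x => Subsingleton.elim (α := M.carrier) _ _)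
  rw [← Abelian.Ext.mk₀_id_comp y, h0, Abelian.Ext.mk₀_zero, Abelian.Ext.zero_comp]
  exact Abelian.Ext.comp_zero _ _ _ _ _

end KoszulDual

end PiecewiseKoszul

/-! ### The main theorem -/

open PiecewiseKoszul

theorem theorem2p7 {F : Type*} [Field F] {A : Type*} [Ring A] [Algebra F A]
    (𝒜 : ℕ → Submodule F A) [GradedAlgebra 𝒜] (h𝒜 : PiecewiseKoszul.IsStandard 𝒜)
    (p d : ℕ) (hp : 2 ≤ p) (hpd : p ≤ d)
    (hA : PiecewiseKoszul.IsPiecewiseKoszulAlgebra 𝒜 p d)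
    (M : PiecewiseKoszul.GrMod 𝒜) (hMfin : Module.Finite A M.carrier)
    (hM : M.GeneratedIn 0) :
    PiecewiseKoszul.IsPiecewiseKoszulModule p d M ↔
      PiecewiseKoszul.KoszulDualGeneratedInDegreeZero M := by
  have := h𝒜.semisimple
  obtain ⟨P, hP⟩ := hA
  obtain ⟨ι, _, f, hf⟩ := exists_hom_finsupp_trivialModule (𝒜 := 𝒜) M.carrier
  let N : GrMod 𝒜 := (trivialGrMod 𝒜).finsupp ι
  let fN : M.carrier →ₗ[A] N.carrier := f
  have hPι : ∀ n, ((P.finsupp ι).obj n).GeneratedIn (delta p d n : ℤ) := fun n => (hP n).finsupp ι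
  have hδ : ((delta p d 0 : ℕ) : ℤ) = 0 := by simp [delta]
  have hNrad : gradedRadical 𝒜 N.carrier = ⊥ :=
    gradedRadical_finsupp_eq_bot ι gradedRadical_trivialModule
  have hfrad : ∀ x, fN x ∈ gradedRadical 𝒜 N.carrier → x ∈ gradedRadical 𝒜 M.carrier := by
    intro x hx
    rw [hNrad, Submodule.mem_bot] at hx
    exact hf.le hx
  -- `N` is concentrated in degree zero, and the components of `M` in other degrees lie in `JM`, the
  -- kernel of `f`.
  have hfgr : IsGradedHom fN := by
    intro j x hx
    by_cases hj : j = 0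
    · subst hj
      intro i
      change f x i ∈ (if (0 : ℤ) = 0 then ⊤ else ⊥ : AddSubgroup (TrivialModule 𝒜))
      rw [if_pos rfl]
      trivial
    · have h0 : fN x = 0 := hf.ge (hM.mem_radical_iff.2 (GrMod.proj_of_mem_ne hx hj))
      rw [h0]
      exact zero_mem _
  constructor
  · rintro ⟨s, Q, hQ⟩
    refine koszulDualGeneratedInDegreeZero_of_extSurjective fN fun n => ?_
    have hs : M.GeneratedIn s := by
      have := (hQ 0).of_surjective Q.ε_graded Q.ε_surjective
      rwa [hδ, zero_add] at this
    -- If `s ≠ 0`, then `M` is generated in two different degrees and is therefore zero; only `s =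
    -- 0` has content.
    rcases lt_trichotomy s 0 with h | h | h
    · have := hs.subsingleton_of_lt hM h
      exact extSurjective_of_subsingleton fN n
    · subst h
      exact extSurjective_of_injective_mod_radical Q (P.finsupp ι)
        (fun n => by simpa using hQ n) hPι hfgr hfrad n
    · have := hM.subsingleton_of_lt hs h
      exact extSurjective_of_subsingleton fN n
  · intro h
    have h0 : ExtSurjective fN 0 := (ModuleCat.extPrecompSurjective_zero_iff fN).2
      (exists_extension_of_injective_mod_gradedRadical gradedRadical_trivialModule fN hfrad)
    have hdom : ExtDominated M fun n => (delta p d n : ℤ) :=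
      ⟨by rwa [hδ], N, P.finsupp ι, fN, hPι, hfgr,
        extSurjective_of_koszulDualGeneratedInDegreeZero h fN h0⟩
    obtain ⟨Q, hQ⟩ := hdom.exists_minimalResolution
    exact ⟨0, Q, fun n => by simpa using hQ n⟩
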